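/- Let $\mathcal X$ and $\mathcal Y_1,\dots,\mathcal Y_K$ be finite nonempty sets, let $W=W_{Y_1\cdots Y_K|X}$ be a discrete memoryless broadcast channel from $\mathcal X$ to $\mathcal Y_1\times\cdots\times\mathcal Y_K$, and let $\epsilon\in(0,1)$. For positive integers $M_1,\dots,M_K$, a size-$(M_1,\dots,M_K)$ $\epsilon$-simulation code for a broadcast channel $V$ from $\mathcal X$ to $\mathcal Y_1\times\cdots\times\mathcal Y_K$ consists of independent discrete random variables $S_1,\dots,S_K$ (of unlimited alphabet size, $S_i$ shared between the sender and receiver $i$), encoders $\mathcal E_{s_1,\dots,s_K}(m_1,\dots,m_K\,|\,x)$ (for every $s_1,\dots,s_K$, a channel from $\mathcal X$ to $[M_1]\times\cdots\times[M_K]$) and decoders $\mathcal D^{(i)}_{s_i}(y_i|m_i)$ (for every $i$ and $s_i$, a channel from $[M_i]$ to $\mathcal Y_i$) such that, for every input distribution $p_X$, the joint law $$p_X(x)\sum_{s_1,\dots,s_K}\prod_{i=1}^K p_{S_i}(s_i)\sum_{m_1,\dots,m_K}\mathcal E_{s_1,\dots,s_K}(m_1,\dots,m_K|x)\prod_{i=1}^K\mathcal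 D^{(i)}_{s_i}(y_i|m_i)$$ is within $\epsilon$ of $p_X(x)\,V(y_1,\dots,y_K|x)$ in total variation distance $\frac12\|\cdot\|_1$. A rate tuple $(r_1,\dots,r_K)\in\mathbb R_{\ge0}^K$ is $\epsilon$-attainable for $W$ if for all sufficiently large $n$ there is a size-$(\lfloor 2^{nr_1}\rfloor,\dots,\lfloor 2^{nr_K}\rfloor)$ $\epsilon$-simulation code for the $n$-fold channel $W^{\otimes n}$ from $\mathcal X^n$ to $\mathcal Y_1^n\times\cdots\times\mathcal Y_K^n$. Let $\mathcal R^\star_\epsilon(W)$ be the closure of the set of $\epsilon$-attainable rate tuples. For nonempty $J=\{j_1,\dots,j_k\}\subseteq\{1,\dots,K\}$ let $W_{Y_J|X}$ be the channel to the outputs in $J$ obtained by summing over the other outputs, and let $$\tilde C(W_{Y_J|X})=\max_{p_X} I(X:Y_{j_1}:\cdots:Y_{j_k})_{p_X\cdot W_{Y_J|X}},\qquad I(X:Y_{j_1}:\cdots:Y_{j_k})_{p}=D\big(p_{XY_{j_1}\cdots Y_{j_k}}\,\big\|\,p_X\times p_{Y_{j_1}}\times\cdots\times p_{Y_{j_k}}\big),$$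 with logarithms to base $2$. Then $$\mathcal R^\star_\epsilon(W)=\Big\{(r_1,\dots,r_K)\in\mathbb R_{\ge 0}^K:\ \sum_{i\in J}r_i\ge\tilde C(W_{Y_J|X})\ \text{ for every nonempty } J\subseteq\{1,\dots,K\}\Big\}.$$ The maxima defining $\tilde C$ are attained, and for a singleton $J=\{i\}$, $\tilde C(W_{Y_J|X})$ is the ordinary capacity $C(W_{Y_i|X})=\max_{p_X}I(X:Y_i)$. In particular, for $K=2$ with outputs $Y,Z$, $$\mathcal R^\star_\epsilon(W_{YZ|X})=\big\{(r_1,r_2)\in\mathbb R_{\ge0}^2:\ r_1\ge C(W_{Y|X}),\ r_2\ge C(W_{Z|X}),\ r_1+r_2\ge\tilde C(W_{YZ|X})\big\}.$$ -/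

import Mathlib

noncomputable section

namespace BroadcastSimulation

/-- A probability mass function on a discrete (possibly infinite) set. -/
def IsPmf {S : Type*} (p : S → ℝ) : Prop :=
  (∀ s, 0 ≤ p s) ∧ HasSum p 1

/-- `V x b` is the conditional probability `V(b | x)` of a discrete memoryless channel with
finite alphabets: every row `V x` is a probability mass function. -/
def IsChannel {X B : Type*} [Fintype B] (V : X → B → ℝ) : Prop :=
  ∀ x, V x ∈ stdSimplex ℝ B

/-- Total variation distance of two mass functions on a finite set. -/
def tvd {A : Type*} [Fintype A] (P Q : A → ℝ) : ℝ :=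
  (1 / 2) * ∑ a, |P a - Q a|

/-- The joint mass function `p_X · V` of input and output. -/
def jointLaw {X B : Type*} (p : X → ℝ) (V : X → B → ℝ) : X → B → ℝ :=
  fun x b => p x * V x b

section Information

variable {X B : Type*} [Fintype X] [Fintype B]

/-- Mutual information `I(X : B) = D(P_{XB} ‖ P_X × P_B)` in bits of a joint mass function `P`.
Whenever the denominator vanishes so does the factor `P x b`, and such terms are `0`. -/
def mutualInfo (P : X → B → ℝ) : ℝ :=
  ∑ x, ∑ b, P x b * Real.logb 2 (P x b / ((∑ b', P x b') * ∑ x', P x' b))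

/-- Capacity `C(V) = max_p I(X : B)_{p · V}` of a point-to-point channel. -/
def capacity (V : X → B → ℝ) : ℝ :=
  sSup ((fun p : X → ℝ => mutualInfo (jointLaw p V)) '' stdSimplex ℝ X)

variable {ι : Type*} [Fintype ι] [DecidableEq ι] {Y : ι → Type*} [∀ i, Fintype (Y i)]

open Classical in
/-- The channel `V_{Y_i | X}` to the single output `i`. -/
def outputChannel (i : ι) (V : X → (∀ j, Y j) → ℝ) : X → Y i → ℝ :=
  fun x b => ∑ y with y i = b, V x y

open Classical in
/-- The channel `V_{Y_J | X}` to the outputs in `J`. -/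
def reducedChannel (J : Finset ι) (V : X → (∀ i, Y i) → ℝ) : X → (∀ j : J, Y j) → ℝ :=
  fun x yJ => ∑ y with J.restrict y = yJ, V x y

open Classical in
/-- The marginal of `Y_i` under a joint mass function `P` of `(X, (Y_i)_i)`. -/
def outputMarginal (P : X → (∀ j, Y j) → ℝ) (i : ι) : Y i → ℝ :=
  fun b => ∑ x, ∑ y with y i = b, P x y

/-- Multipartite mutual information `I(X : Y_1 : ⋯ : Y_k) = D(P ‖ P_X × P_{Y_1} × ⋯ × P_{Y_k})`
in bits. Whenever the denominator vanishes so does `P x y`, and such terms are `0`. -/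
def multiInfo (P : X → (∀ i, Y i) → ℝ) : ℝ :=
  ∑ x, ∑ y, P x y *
    Real.logb 2 (P x y / ((∑ y', P x y') * ∏ i, outputMarginal P i (y i)))

/-- `C̃(V) = max_p I(X : Y_1 : ⋯ : Y_k)_{p · V}`. -/
def multiCapacity (V : X → (∀ i, Y i) → ℝ) : ℝ :=
  sSup ((fun p : X → ℝ => multiInfo (jointLaw p V)) '' stdSimplex ℝ X)

end Information

section Simulation

variable {K : ℕ} {X : Type*} {Y : Fin K → Type*} [∀ i, Fintype (Y i)]

/-- A size-`M` simulation code. The `S i` are independent discrete random variables of unlimited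
size, `S i` being shared between the sender and receiver `i`. The sender knows `x` and all of
`s = (s_1, …, s_K)` and produces the messages jointly (with local randomness); receiver `i` sees
only `s_i` and the message `m_i`, and may use local randomness. -/
structure SimulationCode (X : Type*) (Y : Fin K → Type*) [∀ i, Fintype (Y i)]
    (M : Fin K → ℕ) where
  S : Fin K → Type
  law : ∀ i, S i → ℝ
  law_isPmf : ∀ i, IsPmf (law i)
  enc : (∀ i, S i) → X → (∀ i, Fin (M i)) → ℝ
  enc_isChannel : ∀ s, IsChannel (enc s)
  dec : ∀ i, S i → Fin (M i) → Y i → ℝ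
  dec_isChannel : ∀ i s, IsChannel (dec i s)

/-- The channel that a simulation code induces. The series converges absolutely, being dominated
by the product mass function of the shared randomness. -/
def SimulationCode.induced {M : Fin K → ℕ} (c : SimulationCode X Y M) :
    X → (∀ i, Y i) → ℝ :=
  fun x y => ∑' s : (∀ i, c.S i), (∏ i, c.law i (s i)) *
    ∑ m : (∀ i, Fin (M i)), c.enc s x m * ∏ i, c.dec i (s i) (m i) (y i)

/-- `M` is an `ε`-attainable message-size tuple for `V`: some size-`M` code reproduces the joint
law of input and outputs up to `ε` in total variation, for every input distribution. -/
def Attainable [Fintype X] (ε : ℝ) (V : X → (∀ i, Y i) → ℝ) (M : Fin K → ℕ) : Prop :=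
  ∃ c : SimulationCode X Y M, ∀ p ∈ stdSimplex ℝ X,
    tvd (Function.uncurry (jointLaw p c.induced)) (Function.uncurry (jointLaw p V)) ≤ ε

/-- The `n`-fold memoryless channel `V^{⊗ n}` from `X^n` to `Y_1^n × ⋯ × Y_K^n`. -/
def powerChannel (n : ℕ) (V : X → (∀ i, Y i) → ℝ) :
    (Fin n → X) → (∀ i, Fin n → Y i) → ℝ :=
  fun x y => ∏ t, V (x t) (fun i => y i t)

/-- The closure of the set of `ε`-attainable simulation rate tuples (in bits). -/
def rateRegion [Fintype X] (ε : ℝ) (V : X → (∀ i, Y i) → ℝ) : Set (Fin K → ℝ) :=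
  closure {r | (∀ i, 0 ≤ r i) ∧ ∃ N : ℕ, ∀ n ≥ N,
    Attainable ε (powerChannel n V) (fun i => ⌊(2 : ℝ) ^ ((n : ℝ) * r i)⌋₊)}

end Simulation

end BroadcastSimulation

end

/-! Achievability. Receiver `i` and the sender share `M i` codewords drawn independently from a law
`q i`. To simulate a subnormalised output law `v`, the sender picks the message tuple `m` with
probability proportional to `g = v / ∏ q i` at the codewords it points to. Without normalisation the
average over codebooks is exactly `v`, so the error is the mean deviation of the normaliser
(`totalWeight`) from 1, plus the mass missing from `v`. The second moment of the normaliser expands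
over the sets `J` of receivers at which two output tuples agree: `J = ∅` gives the squared mean, and
a nonempty `J` costs the likelihood ratio of the `J`-marginal of `v` to `∏ q i` over `J`, divided by
`∏ M i` over `J`. This is the source of one rate condition per `J` (`secondMoment_le`,
`exists_code`).

For `n` uses the codebooks must not depend on the input word, so `q i` is the uniform mixture over
all types of the product output laws. As there are polynomially many types, each such law is
dominated at polynomial cost. For every input word, Chebyshev's inequality relative to its own type
keeps the log-likelihood ratio of each `J` below `n (C̃ + δ)` up to vanishing mass; `v` is the
channel restricted to these outputs.

Converse. Bounding each decoder by its sum over all messages removes the encoder, and independence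
of the shared variables makes the result factorise. The `J`-outputs of any code are thus dominated
by a product of masses with totals `M j` (`SimulationCode.reducedChannel_induced_le`). On
independent inputs with `∑ r` over `J` below the information, Markov's and Chebyshev's inequalities
make this product exponentially smaller than the true channel outside a set of vanishing probability
(`one_le_of_le_prod`), so the error tends to 1. Both directions hold for every `ε` in `(0,1)`; the
closure absorbs the `δ` slack. -/

noncomputable section

namespace BroadcastSimulation

/-! ### Independent variables on finite sets and Chebyshev's inequality -/

section FiniteProbability

variable {κ : Type*} [Fintype κ] [DecidableEq κ]

theorem sum_pi_prod {A : κ → Type*} [∀ t, Fintype (A t)] (f : ∀ t, A t → ℝ) :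
    ∑ a : (∀ t, A t), ∏ t, f t (a t) = ∏ t, ∑ b, f t b := by
  rw [Finset.prod_univ_sum, Fintype.piFinset_univ]

theorem prod_mem_stdSimplex {A : κ → Type*} [∀ t, Fintype (A t)] {P : ∀ t, A t → ℝ}
    (hP : ∀ t, P t ∈ stdSimplex ℝ (A t)) :
    (fun a : (∀ t, A t) => ∏ t, P t (a t)) ∈ stdSimplex ℝ (∀ t, A t) := by
  refine ⟨fun a => Finset.prod_nonneg fun t _ => (hP t).1 _, ?_⟩
  rw [sum_pi_prod]
  exact Finset.prod_eq_one fun t _ => (hP t).2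

variable {A : Type*} [Fintype A]

/-- Expectation of a product of functions of two distinct coordinates. -/
theorem sum_prod_mul_mul {P : κ → A → ℝ} (hP : ∀ t, ∑ b, P t b = 1) {t t' : κ} (h : t ≠ t')
    (F G : A → ℝ) :
    ∑ a : κ → A, (∏ u, P u (a u)) * (F (a t) * G (a t')) =
      (∑ b, P t b * F b) * ∑ b, P t' b * G b := by
  have h1 : ∀ a : κ → A, (∏ u, P u (a u)) * (F (a t) * G (a t')) =
      ∏ u, P u (a u) * ((if u = t then F (a u) else 1) * (if u = t' then G (a u) else 1)) := by
    intro a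
    rw [Finset.prod_mul_distrib, Finset.prod_mul_distrib]
    simp
  simp_rw [h1]
  rw [sum_pi_prod (fun u b => P u b * ((if u = t then F b else 1) * (if u = t' then G b else 1)))]
  have h2 : ∀ u, ∑ b, P u b * ((if u = t then F b else 1) * (if u = t' then G b else 1)) =
      (if u = t then ∑ b, P u b * F b else 1) * (if u = t' then ∑ b, P u b * G b else 1) := by
    intro u
    by_cases h3 : u = t
    · subst h3
      simp [h]
    · by_cases h4 : u = t'
      · subst h4
        simp [h3]
      · simp [h3, h4, hP]
  simp_rw [h2]
  rw [Finset.prod_mul_distrib]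
  simp

/-- Expectation of a function of one coordinate. -/
theorem sum_prod_mul {P : κ → A → ℝ} (hP : ∀ t, ∑ b, P t b = 1) (t : κ) (F : A → ℝ) :
    ∑ a : κ → A, (∏ u, P u (a u)) * F (a t) = ∑ b, P t b * F b := by
  have h1 : ∀ a : κ → A, (∏ u, P u (a u)) * F (a t) =
      ∏ u, P u (a u) * (if u = t then F (a u) else 1) := by
    intro a
    rw [Finset.prod_mul_distrib]
    simp
  simp_rw [h1]
  rw [sum_pi_prod (fun u b => P u b * (if u = t then F b else 1))]
  have h2 : ∀ u, ∑ b, P u b * (if u = t then F b else 1) =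
      (if u = t then ∑ b, P u b * F b else 1) := by
    intro u
    by_cases h3 : u = t
    · simp [h3]
    · simp [h3, hP]
  simp_rw [h2]
  simp

/-- After centring, the cross terms vanish by independence and each diagonal term is a variance, at
most `B ^ 2`. The bound on `f` is asked only on the support, where log-likelihood ratios can be
controlled. -/
theorem sum_prod_mul_sq_sum_le {P : κ → A → ℝ} (hP : ∀ t, P t ∈ stdSimplex ℝ A)
    (f : κ → A → ℝ) {B : ℝ} (hf : ∀ t a, P t a ≠ 0 → |f t a| ≤ B) :
    ∑ a : κ → A, (∏ t, P t (a t)) * (∑ t, f t (a t) - ∑ t, ∑ b, P t b * f t b) ^ 2 ≤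
      Fintype.card κ * B ^ 2 := by
  set g : κ → A → ℝ := fun t a => f t a - ∑ b, P t b * f t b with hg
  have hP1 : ∀ t, ∑ b, P t b = 1 := fun t => (hP t).2
  have hg0 : ∀ t, ∑ b, P t b * g t b = 0 := by
    intro t
    simp only [hg, mul_sub, Finset.sum_sub_distrib]
    rw [← Finset.sum_mul, hP1, one_mul, sub_self]
  have h1 : ∀ a : κ → A, (∏ t, P t (a t)) * (∑ t, f t (a t) - ∑ t, ∑ b, P t b * f t b) ^ 2 =
      ∑ t, ∑ t', (∏ t, P t (a t)) * (g t (a t) * g t' (a t')) := by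
    intro a
    rw [← Finset.sum_sub_distrib, sq, Finset.sum_mul_sum, Finset.mul_sum]
    simp_rw [Finset.mul_sum]
    rfl
  simp_rw [h1]
  rw [Finset.sum_comm]
  have h2 : ∀ t, ∑ a : κ → A, ∑ t', (∏ t, P t (a t)) * (g t (a t) * g t' (a t')) ≤ B ^ 2 := by
    intro t
    rw [Finset.sum_comm, Finset.sum_eq_single t]
    · rw [sum_prod_mul hP1 t (fun b => g t b * g t b)]
      have h3 : ∑ b, P t b * (g t b * g t b) =
          ∑ b, P t b * (f t b) ^ 2 - (∑ b, P t b * f t b) ^ 2 := by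
        have h4 : ∀ b, P t b * (g t b * g t b) = P t b * (f t b) ^ 2
            - (∑ b, P t b * f t b) * (P t b * f t b) - (∑ b, P t b * f t b) * (P t b * g t b) := by
          intro b
          simp only [hg]
          ring
        simp_rw [h4]
        rw [Finset.sum_sub_distrib, Finset.sum_sub_distrib, ← Finset.mul_sum, ← Finset.mul_sum, hg0]
        ring
      rw [h3]
      have h5 : ∑ b, P t b * (f t b) ^ 2 ≤ ∑ b, P t b * B ^ 2 := by
        refine Finset.sum_le_sum fun b _ => ?_
        by_cases hb : P t b = 0
        · simp [hb]
        · refine mul_le_mul_of_nonneg_left ?_ ((hP t).1 b)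
          rw [← sq_abs]
          exact pow_le_pow_left₀ (abs_nonneg _) (hf t b hb) 2
      rw [← Finset.sum_mul, hP1, one_mul] at h5
      nlinarith [sq_nonneg (∑ b, P t b * f t b)]
    · intro t' _ h
      rw [sum_prod_mul_mul hP1 h.symm, hg0, zero_mul]
    · simp
  refine (Finset.sum_le_sum fun t _ => h2 t).trans ?_
  simp

/-- Chebyshev's inequality for a sum of independent random variables. -/
theorem chebyshev_pi {P : κ → A → ℝ} (hP : ∀ t, P t ∈ stdSimplex ℝ A)
    (f : κ → A → ℝ) {B : ℝ} (hf : ∀ t a, P t a ≠ 0 → |f t a| ≤ B) {c : ℝ} (hc : 0 < c) :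
    ∑ a : κ → A with c ≤ |∑ t, f t (a t) - ∑ t, ∑ b, P t b * f t b|, ∏ t, P t (a t) ≤
      Fintype.card κ * B ^ 2 / c ^ 2 := by
  rw [le_div_iff₀ (by positivity)]
  refine le_trans ?_ (sum_prod_mul_sq_sum_le hP f hf)
  rw [Finset.sum_filter, Finset.sum_mul]
  refine Finset.sum_le_sum fun a _ => ?_
  have h0 : 0 ≤ ∏ t, P t (a t) := Finset.prod_nonneg fun t _ => (hP t).1 _
  split_ifs with h
  · refine mul_le_mul_of_nonneg_left ?_ h0
    rw [← sq_abs (_ - _)]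
    exact pow_le_pow_left₀ hc.le h 2
  · rw [zero_mul]
    positivity

/-- The law of coordinatewise images under a product law is again a product law. -/
theorem sum_fiber_prod {C : Type*} [DecidableEq C] (P : κ → A → ℝ) (φ : A → C) (z : κ → C) :
    ∑ a : κ → A with (fun t => φ (a t)) = z, ∏ t, P t (a t) =
      ∏ t, ∑ b with φ b = z t, P t b := by
  rw [Finset.prod_univ_sum]
  congr 1
  ext a
  simp [Fintype.mem_piFinset, funext_iff]

theorem sum_mul_comp {C : Type*} [Fintype C] [DecidableEq C] (P : A → ℝ) (φ : A → C) (F : C → ℝ) :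
    ∑ a, P a * F (φ a) = ∑ z, (∑ a with φ a = z, P a) * F z := by
  rw [← Finset.sum_fiberwise (s := Finset.univ) (g := φ)]
  refine Finset.sum_congr rfl fun z _ => ?_
  rw [Finset.sum_mul]
  refine Finset.sum_congr rfl fun a ha => ?_
  rw [(Finset.mem_filter.1 ha).2]

end FiniteProbability

/-! ### Multipartite information and its maximum over inputs -/

section Information

variable {X : Type*} [Fintype X]
variable {ι : Type*} [Fintype ι] [DecidableEq ι] {Y : ι → Type*} [∀ i, Fintype (Y i)]

omit [Fintype X] in
theorem sum_reducedChannel_mul (J : Finset ι) (W : X → (∀ i, Y i) → ℝ) (x : X)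
    (F : (∀ j : J, Y j) → ℝ) :
    ∑ z, reducedChannel J W x z * F z = ∑ y, W x y * F (J.restrict y) := by
  classical
  rw [sum_mul_comp (W x) (fun y => J.restrict y) F]
  refine Finset.sum_congr rfl fun z _ => ?_
  unfold reducedChannel
  congr!

omit [Fintype X] in
theorem isChannel_reducedChannel (J : Finset ι) {W : X → (∀ i, Y i) → ℝ} (hW : IsChannel W) :
    IsChannel (reducedChannel J W) := by
  intro x
  refine ⟨fun z => Finset.sum_nonneg fun y _ => (hW x).1 y, ?_⟩
  simpa [(hW x).2] using sum_reducedChannel_mul J W x fun _ => 1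

omit [Fintype X] in
open Classical in
theorem reducedChannel_restrict (J : Finset ι) (W : X → (∀ i, Y i) → ℝ) (x : X) (y : ∀ i, Y i) :
    reducedChannel J W x (J.restrict y) = ∑ y' with ∀ i ∈ J, y' i = y i, W x y' := by
  unfold reducedChannel
  refine Finset.sum_congr ?_ fun _ _ => rfl
  ext y'
  simp [funext_iff]

theorem outputMarginal_eq (P : X → (∀ j, Y j) → ℝ) (i : ι) (b : Y i) [DecidableEq (Y i)] :
    outputMarginal P i b = ∑ x, ∑ y, P x y * if y i = b then 1 else 0 := by
  unfold outputMarginal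
  refine Finset.sum_congr rfl fun x _ => ?_
  rw [Finset.sum_filter]
  refine Finset.sum_congr rfl fun y _ => ?_
  split_ifs <;> simp

theorem sum_outputMarginal_mul (P : X → (∀ j, Y j) → ℝ) (i : ι) (F : Y i → ℝ) :
    ∑ b, outputMarginal P i b * F b = ∑ x, ∑ y, P x y * F (y i) := by
  classical
  simp_rw [outputMarginal_eq, Finset.sum_mul]
  rw [Finset.sum_comm]
  refine Finset.sum_congr rfl fun x _ => ?_
  rw [Finset.sum_comm]
  refine Finset.sum_congr rfl fun y _ => ?_
  simp

theorem outputMarginal_reducedChannel (p : X → ℝ) (J : Finset ι) (W : X → (∀ i, Y i) → ℝ)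
    (j : J) (b : Y j) :
    outputMarginal (jointLaw p (reducedChannel J W)) j b = outputMarginal (jointLaw p W) j b := by
  classical
  simp_rw [outputMarginal_eq, jointLaw, mul_assoc, ← Finset.mul_sum]
  refine Finset.sum_congr rfl fun x _ => ?_
  rw [sum_reducedChannel_mul J W x fun z => if z j = b then 1 else 0]
  rfl

theorem outputMarginal_nonneg {P : X → (∀ j, Y j) → ℝ} (hP : ∀ x y, 0 ≤ P x y) (i : ι) (b : Y i) :
    0 ≤ outputMarginal P i b :=
  Finset.sum_nonneg fun _ _ => Finset.sum_nonneg fun _ _ => hP _ _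

theorem le_outputMarginal {P : X → (∀ j, Y j) → ℝ} (hP : ∀ x y, 0 ≤ P x y) (i : ι) (x : X)
    (y : ∀ j, Y j) : P x y ≤ outputMarginal P i (y i) := by
  classical
  rw [outputMarginal_eq]
  have h0 : ∀ x y', 0 ≤ P x y' * if y' i = y i then 1 else 0 := fun x y' =>
    mul_nonneg (hP x y') (by split_ifs <;> norm_num)
  calc P x y = P x y * if y i = y i then 1 else 0 := by simp
    _ ≤ ∑ y', P x y' * if y' i = y i then 1 else 0 :=
      Finset.single_le_sum (f := fun y' => P x y' * if y' i = y i then 1 else 0)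
        (fun y' _ => h0 x y') (Finset.mem_univ y)
    _ ≤ _ := Finset.single_le_sum (f := fun x => ∑ y', P x y' * if y' i = y i then 1 else 0)
        (fun x _ => Finset.sum_nonneg fun y' _ => h0 x y') (Finset.mem_univ x)

theorem jointLaw_nonneg {p : X → ℝ} (hp : p ∈ stdSimplex ℝ X) {V : X → (∀ i, Y i) → ℝ}
    (hV : IsChannel V) (x : X) (y : ∀ i, Y i) : 0 ≤ jointLaw p V x y :=
  mul_nonneg (hp.1 x) ((hV x).1 y)

theorem outputMarginal_mem_stdSimplex {p : X → ℝ} (hp : p ∈ stdSimplex ℝ X)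
    {V : X → (∀ i, Y i) → ℝ} (hV : IsChannel V) (i : ι) :
    outputMarginal (jointLaw p V) i ∈ stdSimplex ℝ (Y i) := by
  refine ⟨outputMarginal_nonneg (jointLaw_nonneg hp hV) i, ?_⟩
  have := sum_outputMarginal_mul (jointLaw p V) i fun _ => 1
  simp only [mul_one, jointLaw, ← Finset.mul_sum, (hV _).2, hp.2] at this
  exact this

/-- The log-likelihood ratio whose expectation is the multipartite information of the outputs
in `J`. -/
def infoDensity (J : Finset ι) (W : X → (∀ i, Y i) → ℝ) (p : X → ℝ) (x : X) (y : ∀ i, Y i) : ℝ :=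
  Real.logb 2 (reducedChannel J W x (J.restrict y) /
    ∏ i ∈ J, outputMarginal (jointLaw p W) i (y i))

theorem multiInfo_jointLaw {V : X → (∀ i, Y i) → ℝ} (hV : IsChannel V) (p : X → ℝ) :
    multiInfo (jointLaw p V) = ∑ x, p x * ∑ y, V x y *
      Real.logb 2 (V x y / ∏ i, outputMarginal (jointLaw p V) i (y i)) := by
  unfold multiInfo
  refine Finset.sum_congr rfl fun x _ => ?_
  rw [Finset.mul_sum]
  refine Finset.sum_congr rfl fun y _ => ?_
  have h : ∑ y', jointLaw p V x y' = p x := by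
    simp only [jointLaw, ← Finset.mul_sum, (hV x).2, mul_one]
  rw [h, ← mul_assoc]
  by_cases hx : p x = 0
  · simp [jointLaw, hx]
  · congr 2
    exact mul_div_mul_left _ _ hx

theorem multiInfo_reducedChannel {W : X → (∀ i, Y i) → ℝ} (hW : IsChannel W) (J : Finset ι)
    (p : X → ℝ) :
    multiInfo (jointLaw p (reducedChannel J W)) =
      ∑ x, p x * ∑ y, W x y * infoDensity J W p x y := by
  rw [multiInfo_jointLaw (isChannel_reducedChannel J hW)]
  refine Finset.sum_congr rfl fun x _ => ?_
  rw [sum_reducedChannel_mul J W x fun z => Real.logb 2 (reducedChannel J W x z /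
    ∏ j, outputMarginal (jointLaw p (reducedChannel J W)) j (z j))]
  simp_rw [outputMarginal_reducedChannel, infoDensity]
  refine congrArg _ (Finset.sum_congr rfl fun y _ => ?_)
  rw [← Finset.prod_coe_sort J]
  rfl

/-- On the simplex the information is a linear function of `p` plus the entropies of the output
marginals, and `t ↦ t * log t` is continuous, also at 0. -/
theorem continuousOn_multiInfo {V : X → (∀ i, Y i) → ℝ} (hV : IsChannel V) :
    ContinuousOn (fun p : X → ℝ => multiInfo (jointLaw p V)) (stdSimplex ℝ X) := by
  have h1 : ∀ p ∈ stdSimplex ℝ X, multiInfo (jointLaw p V) =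
      (∑ x, p x * (∑ y, V x y * Real.log (V x y)) - ∑ i, ∑ b,
        outputMarginal (jointLaw p V) i b * Real.log (outputMarginal (jointLaw p V) i b)) /
          Real.log 2 := by
    intro p hp
    -- Where the joint mass vanishes both sides are zero; elsewhere every marginal is positive and
    -- the logarithm splits.
    have h2 : ∀ x y, p x * (V x y * Real.logb 2
        (V x y / ∏ i, outputMarginal (jointLaw p V) i (y i))) =
        (p x * (V x y * Real.log (V x y)) - ∑ i, jointLaw p V x y *
          Real.log (outputMarginal (jointLaw p V) i (y i))) / Real.log 2 := by
      intro x y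
      by_cases h : jointLaw p V x y = 0
      · have h' : p x * V x y = 0 := h
        rw [h]
        simp [← mul_assoc, h']
      · have h3 : V x y ≠ 0 := fun h' => h (by simp [jointLaw, h'])
        have h4 : ∀ i, outputMarginal (jointLaw p V) i (y i) ≠ 0 := fun i =>
          (lt_of_lt_of_le (lt_of_le_of_ne (jointLaw_nonneg hp hV x y) (Ne.symm h))
            (le_outputMarginal (jointLaw_nonneg hp hV) i x y)).ne'
        rw [Real.logb, Real.log_div h3 (Finset.prod_ne_zero_iff.2 fun i _ => h4 i),
          Real.log_prod fun i _ => h4 i, ← Finset.mul_sum, jointLaw]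
        ring
    rw [multiInfo_jointLaw hV]
    simp_rw [Finset.mul_sum, h2, sum_outputMarginal_mul]
    simp_rw [← Finset.sum_div, Finset.sum_sub_distrib]
    congr 2
    symm
    rw [Finset.sum_comm]
    exact Finset.sum_congr rfl fun x _ => Finset.sum_comm
  refine ContinuousOn.congr (Continuous.continuousOn ?_) h1
  have h5 : ∀ i (b : Y i), Continuous fun p : X → ℝ => outputMarginal (jointLaw p V) i b := by
    intro i b
    unfold outputMarginal jointLaw
    fun_prop
  refine Continuous.div_const (Continuous.sub (by fun_prop) ?_) _
  exact continuous_finsetSum _ fun i _ => continuous_finsetSum _ fun b _ =>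
    Real.continuous_mul_log.comp (h5 i b)

theorem isGreatest_multiCapacity [Nonempty X] {V : X → (∀ i, Y i) → ℝ} (hV : IsChannel V) :
    IsGreatest ((fun p : X → ℝ => multiInfo (jointLaw p V)) '' stdSimplex ℝ X)
      (multiCapacity V) := by
  classical
  refine IsCompact.isGreatest_sSup ((isCompact_stdSimplex ℝ X).image_of_continuousOn
    (continuousOn_multiInfo hV)) (Set.Nonempty.image _ ?_)
  exact ⟨_, single_mem_stdSimplex ℝ (Classical.arbitrary X)⟩

omit [Fintype X] in
theorem reducedChannel_singleton (i : ι) (W : X → (∀ j, Y j) → ℝ) (x : X) (y : ∀ j, Y j) :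
    reducedChannel {i} W x (Finset.restrict {i} y) = outputChannel i W x (y i) := by
  classical
  rw [reducedChannel_restrict]
  unfold outputChannel
  refine Finset.sum_congr ?_ fun _ _ => rfl
  ext
  simp

theorem multiCapacity_singleton {W : X → (∀ j, Y j) → ℝ} (hW : IsChannel W) (i : ι) :
    multiCapacity (reducedChannel {i} W) = capacity (outputChannel i W) := by
  classical
  unfold multiCapacity capacity
  refine congrArg sSup (Set.image_congr fun p _ => ?_)
  rw [multiInfo_reducedChannel hW]
  unfold mutualInfo
  refine Finset.sum_congr rfl fun x _ => ?_
  have h1 : ∀ b, ∑ x', jointLaw p (outputChannel i W) x' b = outputMarginal (jointLaw p W) i b := by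
    intro b
    unfold outputMarginal jointLaw outputChannel
    simp_rw [Finset.mul_sum]
  have h3 : ∀ F : Y i → ℝ, ∑ b, outputChannel i W x b * F b = ∑ y, W x y * F (y i) := by
    intro F
    rw [sum_mul_comp (W x) (fun y => y i) F]
    refine Finset.sum_congr rfl fun z _ => ?_
    unfold outputChannel
    congr!
  have h2 : ∑ b, jointLaw p (outputChannel i W) x b = p x := by
    have h4 := h3 fun _ => 1
    simp only [mul_one, (hW x).2] at h4
    simp only [jointLaw]
    rw [← Finset.mul_sum, h4, mul_one]
  simp_rw [h1, h2]
  by_cases hx : p x = 0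
  · simp [jointLaw, hx]
  · simp_rw [jointLaw, mul_assoc, mul_div_mul_left _ _ hx]
    rw [← Finset.mul_sum, h3 fun b => Real.logb 2 (outputChannel i W x b /
      outputMarginal (jointLaw p W) i b)]
    refine congrArg _ (Finset.sum_congr rfl fun y _ => ?_)
    rw [infoDensity, reducedChannel_singleton, Finset.prod_singleton]

theorem multiCapacity_univ {W : X → (∀ j, Y j) → ℝ} (hW : IsChannel W) :
    multiCapacity (reducedChannel Finset.univ W) = multiCapacity W := by
  classical
  unfold multiCapacity
  refine congrArg sSup (Set.image_congr fun p _ => ?_)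
  rw [multiInfo_reducedChannel hW, multiInfo_jointLaw hW]
  refine Finset.sum_congr rfl fun x _ => congrArg _ (Finset.sum_congr rfl fun y _ => ?_)
  rw [infoDensity, reducedChannel_restrict, Finset.sum_eq_single y]
  · intro y' h h'
    exact absurd (funext fun i => (Finset.mem_filter.1 h).2 i (Finset.mem_univ i)) h'
  · simp

end Information

/-! ### Letter frequencies in a random codebook -/

section Codebook

open Classical in
/-- The relative frequency of the letter `b` in the word `s`. -/
def freq {A : Type*} {M : ℕ} (s : Fin M → A) (b : A) : ℝ :=
  (M : ℝ)⁻¹ * ∑ k, if s k = b then 1 else 0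

theorem freq_nonneg {A : Type*} {M : ℕ} (s : Fin M → A) (b : A) : 0 ≤ freq s b := by
  unfold freq
  positivity

variable {A : Type*} [Fintype A] {M : ℕ} {q : A → ℝ}

theorem sum_prod_mul_freq (hM : 0 < M) (hq : q ∈ stdSimplex ℝ A) (b : A) :
    ∑ s : Fin M → A, (∏ k, q (s k)) * freq s b = q b := by
  classical
  have h1 : ∀ s : Fin M → A, (∏ k, q (s k)) * freq s b =
      (M : ℝ)⁻¹ * ∑ k, (∏ k, q (s k)) * (if s k = b then 1 else 0) := by
    intro s
    unfold freq
    rw [← Finset.mul_sum]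
    ring
  simp_rw [h1]
  rw [← Finset.mul_sum, Finset.sum_comm]
  simp_rw [sum_prod_mul (P := fun _ : Fin M => q) (fun _ => hq.2) _
    (fun a => if a = b then (1 : ℝ) else 0)]
  have : (M : ℝ) ≠ 0 := by positivity
  simp [this]

open Classical in
-- Distinct positions are independent and contribute `q b * q b'`; equal positions contribute `q b`
-- if `b = b'`. Granting the diagonal the product term as well gives up equality for a form that
-- multiplies well over receivers.
theorem sum_prod_mul_freq_mul_freq_le (hM : 0 < M) (hq : q ∈ stdSimplex ℝ A) (b b' : A) :
    ∑ s : Fin M → A, (∏ k, q (s k)) * (freq s b * freq s b') ≤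
      q b * q b' + if b = b' then q b / M else 0 := by
  have h1 : ∀ s : Fin M → A, (∏ k, q (s k)) * (freq s b * freq s b') =
      ((M : ℝ)⁻¹ * (M : ℝ)⁻¹) * ∑ k, ∑ k', (∏ k, q (s k)) *
        ((if s k = b then 1 else 0) * (if s k' = b' then 1 else 0)) := by
    intro s
    unfold freq
    simp_rw [← Finset.mul_sum]
    rw [← Finset.sum_mul]
    ring
  simp_rw [h1]
  have hM' : (0 : ℝ) < M := by positivity
  rw [← Finset.mul_sum, Finset.sum_comm]
  have h2 : ∀ k : Fin M, ∑ s : Fin M → A, ∑ k', (∏ k, q (s k)) *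
        ((if s k = b then 1 else 0) * (if s k' = b' then (1 : ℝ) else 0)) ≤
      M * (q b * q b') + if b = b' then q b else 0 := by
    intro k
    rw [Finset.sum_comm]
    have h3 : ∀ k' : Fin M, ∑ s : Fin M → A, (∏ k, q (s k)) *
        ((if s k = b then 1 else 0) * (if s k' = b' then (1 : ℝ) else 0)) ≤
        q b * q b' + if k' = k then (if b = b' then q b else 0) else 0 := by
      intro k'
      have hqq : 0 ≤ q b * q b' := mul_nonneg (hq.1 _) (hq.1 _)
      by_cases hk : k' = k
      · subst hk
        rw [sum_prod_mul (P := fun _ : Fin M => q) (fun _ => hq.2) _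
          (fun a => (if a = b then (1 : ℝ) else 0) * (if a = b' then (1 : ℝ) else 0))]
        have : ∑ a, q a * ((if a = b then (1 : ℝ) else 0) * (if a = b' then (1 : ℝ) else 0)) =
            if b = b' then q b else 0 := by
          rw [Finset.sum_eq_single b]
          · simp
          · intro a _ h
            simp [h]
          · simp
        rw [this]
        simpa using hqq
      · rw [sum_prod_mul_mul (P := fun _ : Fin M => q) (fun _ => hq.2) (Ne.symm hk)
          (fun a => (if a = b then (1 : ℝ) else 0)) (fun a => (if a = b' then (1 : ℝ) else 0))]
        simp [hk]
    refine (Finset.sum_le_sum fun k' _ => h3 k').trans ?_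
    rw [Finset.sum_add_distrib]
    simp
  refine (mul_le_mul_of_nonneg_left (Finset.sum_le_sum fun k _ => h2 k) (by positivity)).trans ?_
  simp only [Finset.sum_const, Finset.card_univ, Fintype.card_fin, nsmul_eq_mul]
  apply le_of_eq
  split_ifs
  · field_simp
  · field_simp
    ring

end Codebook

/-! ### One-shot simulation with random codebooks -/

section OneShot

variable {K : ℕ} {Z : Fin K → Type*} [∀ i, Fintype (Z i)] {M : Fin K → ℕ}

/-- Mass of a tuple of codebooks whose codewords are drawn independently. -/
def codebookLaw (q : ∀ i, Z i → ℝ) (s : ∀ i, Fin (M i) → Z i) : ℝ :=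
  ∏ i, ∏ k, q i (s i k)

/-- The weight that message `m` has for a sender who targets the density `g`. -/
def messageWeight (g : (∀ i, Z i) → ℝ) (s : ∀ i, Fin (M i) → Z i) (m : ∀ i, Fin (M i)) : ℝ :=
  (∏ i, (M i : ℝ)⁻¹) * g (fun i => s i (m i))

def totalWeight (g : (∀ i, Z i) → ℝ) (s : ∀ i, Fin (M i) → Z i) : ℝ :=
  ∑ m, messageWeight g s m

theorem codebookLaw_mem_stdSimplex {q : ∀ i, Z i → ℝ} (hq : ∀ i, q i ∈ stdSimplex ℝ (Z i)) :
    codebookLaw (M := M) q ∈ stdSimplex ℝ _ :=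
  prod_mem_stdSimplex fun i => prod_mem_stdSimplex fun _ => hq i

omit [∀ i, Fintype (Z i)] in
open Classical in
-- Decoding to `y` is a separate condition on each receiver's message, so the count of such messages
-- is a product of counts.
theorem sum_messageWeight_fiber (g : (∀ i, Z i) → ℝ) (s : ∀ i, Fin (M i) → Z i) (y : ∀ i, Z i) :
    ∑ m with (fun i => s i (m i)) = y, messageWeight g s m = g y * ∏ i, freq (s i) (y i) := by
  have h1 : ∑ m with (fun i => s i (m i)) = y, messageWeight g s m =
      ∑ m : (∀ i, Fin (M i)), g y * ∏ i, ((M i : ℝ)⁻¹ * if s i (m i) = y i then 1 else 0) := by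
    rw [Finset.sum_filter]
    refine Finset.sum_congr rfl fun m _ => ?_
    rw [Finset.prod_mul_distrib, Finset.prod_ite_zero]
    split_ifs with h h' h'
    · subst h
      simp [messageWeight, mul_comm]
    · exact absurd (fun i _ => congrFun h i) h'
    · exact absurd (funext fun i => h' i (Finset.mem_univ i)) h
    · simp
  rw [h1, ← Finset.mul_sum,
    sum_pi_prod (fun i k => (M i : ℝ)⁻¹ * if s i k = y i then (1 : ℝ) else 0)]
  simp_rw [← Finset.mul_sum]
  rfl

theorem totalWeight_eq (g : (∀ i, Z i) → ℝ) (s : ∀ i, Fin (M i) → Z i) :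
    totalWeight g s = ∑ y, g y * ∏ i, freq (s i) (y i) := by
  classical
  simp_rw [← sum_messageWeight_fiber]
  rw [Finset.sum_fiberwise]
  rfl

theorem sum_codebookLaw_mul_prod (q : ∀ i, Z i → ℝ) (F : ∀ i, (Fin (M i) → Z i) → ℝ) :
    ∑ s, codebookLaw (M := M) q s * ∏ i, F i (s i) =
      ∏ i, ∑ t : Fin (M i) → Z i, (∏ k, q i (t k)) * F i t := by
  rw [← sum_pi_prod (fun i (t : Fin (M i) → Z i) => (∏ k, q i (t k)) * F i t)]
  simp_rw [Finset.prod_mul_distrib]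
  rfl

variable {q : ∀ i, Z i → ℝ}

theorem sum_codebookLaw_mul_freq (hM : ∀ i, 0 < M i) (hq : ∀ i, q i ∈ stdSimplex ℝ (Z i))
    (g : (∀ i, Z i) → ℝ) (y : ∀ i, Z i) :
    ∑ s, codebookLaw (M := M) q s * (g y * ∏ i, freq (s i) (y i)) = g y * ∏ i, q i (y i) := by
  simp_rw [mul_left_comm _ (g y)]
  rw [← Finset.mul_sum, sum_codebookLaw_mul_prod q (fun i t => freq t (y i))]
  simp_rw [sum_prod_mul_freq (hM _) (hq _)]

open Classical in
theorem sum_codebookLaw_mul_sq_le (hM : ∀ i, 0 < M i) (hq : ∀ i, q i ∈ stdSimplex ℝ (Z i))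
    {g : (∀ i, Z i) → ℝ} (hg : ∀ y, 0 ≤ g y) :
    ∑ s, codebookLaw (M := M) q s * totalWeight g s ^ 2 ≤
      ∑ y, ∑ y', g y * g y' *
        ∏ i, (q i (y i) * q i (y' i) + if y i = y' i then q i (y i) / M i else 0) := by
  have h1 : ∀ s, codebookLaw (M := M) q s * totalWeight g s ^ 2 =
      ∑ y, ∑ y', g y * g y' *
        (codebookLaw (M := M) q s * ∏ i, (freq (s i) (y i) * freq (s i) (y' i))) := by
    intro s
    rw [totalWeight_eq, sq, Finset.sum_mul_sum, Finset.mul_sum]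
    refine Finset.sum_congr rfl fun y _ => ?_
    rw [Finset.mul_sum]
    refine Finset.sum_congr rfl fun y' _ => ?_
    rw [Finset.prod_mul_distrib]
    ring
  simp_rw [h1]
  rw [Finset.sum_comm]
  refine Finset.sum_le_sum fun y _ => ?_
  rw [Finset.sum_comm]
  refine Finset.sum_le_sum fun y' _ => ?_
  rw [← Finset.mul_sum, sum_codebookLaw_mul_prod q (fun i t => freq t (y i) * freq t (y' i))]
  refine mul_le_mul_of_nonneg_left ?_ (mul_nonneg (hg _) (hg _))
  refine Finset.prod_le_prod (fun i _ => ?_) fun i _ =>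
    sum_prod_mul_freq_mul_freq_le (hM i) (hq i) _ _
  exact Finset.sum_nonneg fun t _ => mul_nonneg (Finset.prod_nonneg fun k _ => (hq i).1 _)
    (mul_nonneg (freq_nonneg _ _) (freq_nonneg _ _))

open Classical in
-- Expanding the product of collision factors gives a sum over sets `J` of receivers at which `y`
-- and `y'` agree. For `J = ∅` it is the squared mean; otherwise summing over `y'` leaves the
-- `J`-marginal of `v`, which `hB` bounds.
theorem secondMoment_le (hM : ∀ i, 0 < M i) (hq : ∀ i, q i ∈ stdSimplex ℝ (Z i))
    {v : (∀ i, Z i) → ℝ} (hv : ∀ y, 0 ≤ v y) (hv1 : ∑ y, v y ≤ 1)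
    {B : Finset (Fin K) → ℝ} (hB0 : ∀ J, 0 ≤ B J)
    (hB : ∀ y, v y ≠ 0 → ∀ J : Finset (Fin K), J.Nonempty →
      ∑ y' with ∀ i ∈ J, y' i = y i, v y' ≤ B J * ∏ i ∈ J, q i (y i)) :
    ∑ s, codebookLaw (M := M) q s * totalWeight (fun y => v y / ∏ i, q i (y i)) s ^ 2 ≤
      (∑ y, v y) ^ 2 + ∑ J : Finset (Fin K) with J.Nonempty, B J / ∏ i ∈ J, (M i : ℝ) := by
  refine (sum_codebookLaw_mul_sq_le hM hq fun y =>
    div_nonneg (hv y) (Finset.prod_nonneg fun i _ => (hq i).1 _)).trans ?_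
  -- The hypothesis `hB` for singletons already forces absolute continuity with respect to each `q
  -- i`.
  have hq0 : ∀ y, v y ≠ 0 → ∀ i, q i (y i) ≠ 0 := by
    intro y hy i hi
    have h1 := hB y hy {i} (Finset.singleton_nonempty i)
    rw [Finset.prod_singleton, hi, mul_zero] at h1
    have h2 : v y ≤ ∑ y' with ∀ j ∈ ({i} : Finset (Fin K)), y' j = y j, v y' :=
      Finset.single_le_sum (f := v) (fun y _ => hv y) (by simp)
    exact hy (le_antisymm (h2.trans h1) (hv y))
  have h1 : ∀ y y' : (∀ i, Z i), v y / (∏ i, q i (y i)) * (v y' / ∏ i, q i (y' i)) *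
        ∏ i, (q i (y i) * q i (y' i) + (if y i = y' i then q i (y i) / M i else 0)) =
      ∑ J : Finset (Fin K), (v y * ∏ i ∈ J, ((M i : ℝ)⁻¹ * (q i (y i))⁻¹)) *
        (if ∀ i ∈ J, y' i = y i then v y' else 0) := by
    intro y y'
    by_cases hy : v y = 0
    · simp [hy]
    by_cases hy' : v y' = 0
    · simp [hy']
    have h2 : v y / (∏ i, q i (y i)) * (v y' / ∏ i, q i (y' i)) *
        ∏ i, (q i (y i) * q i (y' i) + (if y i = y' i then q i (y i) / M i else 0)) =
        v y * v y' * ∏ i, (1 + (M i : ℝ)⁻¹ * (q i (y i))⁻¹ * if y' i = y i then 1 else 0) := by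
      have h3 : ∀ i, q i (y i) * q i (y' i) + (if y i = y' i then q i (y i) / M i else 0) =
          q i (y i) * q i (y' i) *
            (1 + (M i : ℝ)⁻¹ * (q i (y i))⁻¹ * if y' i = y i then 1 else 0) := by
        intro i
        have := hq0 y hy i
        by_cases h : y' i = y i
        · simp only [h, if_true]
          field_simp
        · simp [h, Ne.symm h]
      simp_rw [h3]
      rw [Finset.prod_mul_distrib, Finset.prod_mul_distrib]
      have h4 : ∏ i, q i (y i) ≠ 0 := Finset.prod_ne_zero_iff.2 fun i _ => hq0 y hy i
      have h5 : ∏ i, q i (y' i) ≠ 0 := Finset.prod_ne_zero_iff.2 fun i _ => hq0 y' hy' i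
      field_simp
    rw [h2, Finset.prod_one_add, Finset.powerset_univ, Finset.mul_sum]
    refine Finset.sum_congr rfl fun J _ => ?_
    rw [Finset.prod_mul_distrib, Finset.prod_ite_zero]
    split_ifs <;> simp
    ring
  simp_rw [h1]
  have h6 : ∑ y, ∑ y', ∑ J : Finset (Fin K), (v y * ∏ i ∈ J, ((M i : ℝ)⁻¹ * (q i (y i))⁻¹)) *
        (if ∀ i ∈ J, y' i = y i then v y' else 0) =
      ∑ J : Finset (Fin K), ∑ y, (v y * ∏ i ∈ J, ((M i : ℝ)⁻¹ * (q i (y i))⁻¹)) *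
        ∑ y' with ∀ i ∈ J, y' i = y i, v y' := by
    rw [Finset.sum_comm]
    simp_rw [Finset.sum_filter, Finset.mul_sum]
    rw [Finset.sum_comm]
    simp_rw [Finset.sum_comm (s := (Finset.univ : Finset (∀ i, Z i)))
      (t := (Finset.univ : Finset (Finset (Fin K))))]
  rw [h6, ← Finset.sum_filter_add_sum_filter_not Finset.univ
    (fun J : Finset (Fin K) => J.Nonempty), add_comm]
  refine add_le_add (le_of_eq ?_) (Finset.sum_le_sum fun J hJ => ?_)
  · have h7 : (Finset.univ.filter fun J : Finset (Fin K) => ¬ J.Nonempty) = {∅} := by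
      ext J
      simp
    rw [h7, Finset.sum_singleton, sq, Finset.sum_mul]
    simp
  · have h8 : ∀ y, (v y * ∏ i ∈ J, ((M i : ℝ)⁻¹ * (q i (y i))⁻¹)) *
        ∑ y' with ∀ i ∈ J, y' i = y i, v y' ≤ v y * (B J / ∏ i ∈ J, (M i : ℝ)) := by
      intro y
      by_cases hy : v y = 0
      · simp [hy]
      rw [mul_assoc]
      refine mul_le_mul_of_nonneg_left ?_ (hv y)
      refine (mul_le_mul_of_nonneg_left (hB y hy J (Finset.mem_filter.1 hJ).2)
        (Finset.prod_nonneg fun i _ => mul_nonneg (by positivity)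
          (inv_nonneg.2 ((hq i).1 _)))).trans (le_of_eq ?_)
      rw [Finset.prod_mul_distrib, Finset.prod_inv_distrib, Finset.prod_inv_distrib]
      have : ∏ i ∈ J, q i (y i) ≠ 0 := Finset.prod_ne_zero_iff.2 fun i _ => hq0 y hy i
      field_simp
    refine (Finset.sum_le_sum fun y _ => h8 y).trans ?_
    rw [← Finset.sum_mul]
    refine mul_le_of_le_one_left (div_nonneg (hB0 J) ?_) hv1
    positivity

/-- The sender, who targets the density `g`, picks message `m` with probability proportional to its
weight. -/
def encoder (hM : ∀ i, 0 < M i) (g : (∀ i, Z i) → ℝ) (s : ∀ i, Fin (M i) → Z i) :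
    (∀ i, Fin (M i)) → ℝ :=
  -- With no weight to normalise, any fixed message does: the distance to the weights is then 1, as
  -- `sum_abs_encoder_sub` needs.
  if totalWeight g s = 0 then Pi.single (fun i => ⟨0, hM i⟩) 1
  else fun m => messageWeight g s m / totalWeight g s

omit [∀ i, Fintype (Z i)] in
theorem encoder_mem_stdSimplex (hM : ∀ i, 0 < M i) {g : (∀ i, Z i) → ℝ} (hg : ∀ y, 0 ≤ g y)
    (s : ∀ i, Fin (M i) → Z i) : encoder hM g s ∈ stdSimplex ℝ _ := by
  have h0 : ∀ m, 0 ≤ messageWeight g s m := fun m => mul_nonneg (by positivity) (hg _)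
  unfold encoder
  split_ifs with h
  · exact single_mem_stdSimplex ℝ _
  · refine ⟨fun m => div_nonneg (h0 m) (Finset.sum_nonneg fun m _ => h0 m), ?_⟩
    rw [← Finset.sum_div]
    exact div_self h

omit [∀ i, Fintype (Z i)] in
-- Normalising rescales all weights by one factor, so the cost is exactly the defect of the total.
theorem sum_abs_encoder_sub (hM : ∀ i, 0 < M i) {g : (∀ i, Z i) → ℝ} (hg : ∀ y, 0 ≤ g y)
    (s : ∀ i, Fin (M i) → Z i) :
    ∑ m, |encoder hM g s m - messageWeight g s m| = |1 - totalWeight g s| := by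
  have h0 : ∀ m, 0 ≤ messageWeight g s m := fun m => mul_nonneg (by positivity) (hg _)
  have h1 := encoder_mem_stdSimplex hM hg s
  by_cases h : totalWeight g s = 0
  · have h2 : ∀ m, messageWeight g s m = 0 := fun m =>
      (Finset.sum_eq_zero_iff_of_nonneg fun m _ => h0 m).1 h m (Finset.mem_univ m)
    simp_rw [h2, h, sub_zero, abs_one, abs_of_nonneg (h1.1 _)]
    exact h1.2
  · have h2 : ∀ m, encoder hM g s m - messageWeight g s m =
        encoder hM g s m * (1 - totalWeight g s) := by
      intro m
      simp only [encoder, h, if_false]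
      field_simp
    simp_rw [h2, abs_mul, abs_of_nonneg (h1.1 _)]
    rw [← Finset.sum_mul, h1.2, one_mul]

open Classical in
/-- The code in which all receivers share independently drawn codebooks with the sender. -/
def codebookCode {X : Type*} (hM : ∀ i, 0 < M i) (hq : ∀ i, q i ∈ stdSimplex ℝ (Z i))
    (g : X → (∀ i, Z i) → ℝ) (hg : ∀ x y, 0 ≤ g x y) : SimulationCode X Z M where
  -- A code asks for shared variables in `Type`, while `Z i` may live in a higher universe;
  -- finiteness makes the codebooks small.
  S i := Shrink.{0} (Fin (M i) → Z i)
  law i s := ∏ k, q i ((equivShrink _).symm s k)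
  law_isPmf i := by
    refine ⟨fun s => Finset.prod_nonneg fun k _ => (hq i).1 _, ?_⟩
    have h := prod_mem_stdSimplex fun _ : Fin (M i) => hq i
    refine ((equivShrink (Fin (M i) → Z i)).symm.hasSum_iff
      (f := fun s : Fin (M i) → Z i => ∏ k, q i (s k))).2 ?_
    rw [← h.2]
    exact hasSum_fintype _
  enc s x := encoder hM (g x) fun i => (equivShrink _).symm (s i)
  enc_isChannel s x := encoder_mem_stdSimplex hM (hg x) _
  dec i s m b := if (equivShrink (Fin (M i) → Z i)).symm s m = b then 1 else 0
  dec_isChannel i s m := by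
    refine ⟨fun b => ?_, ?_⟩
    · dsimp only
      split_ifs <;> norm_num
    · simp

open Classical in
theorem codebookCode_induced {X : Type*} (hM : ∀ i, 0 < M i) (hq : ∀ i, q i ∈ stdSimplex ℝ (Z i))
    (g : X → (∀ i, Z i) → ℝ) (hg : ∀ x y, 0 ≤ g x y) (x : X) (y : ∀ i, Z i) :
    (codebookCode hM hq g hg).induced x y = ∑ s, codebookLaw (M := M) q s *
      ∑ m with (fun i => s i (m i)) = y, encoder hM (g x) s m := by
  rw [← tsum_fintype (L := SummationFilter.unconditional _), ← Equiv.tsum_eq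
    (Equiv.piCongrRight fun i => (equivShrink.{0} (Fin (M i) → Z i)).symm)]
  refine tsum_congr fun s => ?_
  rw [Finset.sum_filter]
  refine congrArg₂ _ rfl (Finset.sum_congr rfl fun m _ => ?_)
  simp only [codebookCode, Finset.prod_ite_zero]
  split_ifs with h h' h'
  · simp
    rfl
  · exact absurd (funext fun i => h i (Finset.mem_univ i)) h'
  · exact absurd (fun i _ => congrFun h' i) h
  · simp

/-- The target is the codebook average of the unnormalised weights, so the triangle inequality
compares encoder and weights one codebook at a time. -/
theorem sum_abs_codebookCode_induced_sub_le {X : Type*} (hM : ∀ i, 0 < M i)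
    (hq : ∀ i, q i ∈ stdSimplex ℝ (Z i)) (g : X → (∀ i, Z i) → ℝ) (hg : ∀ x y, 0 ≤ g x y) (x : X) :
    ∑ y, |(codebookCode hM hq g hg).induced x y - g x y * ∏ i, q i (y i)| ≤
      ∑ s, codebookLaw (M := M) q s * |1 - totalWeight (g x) s| := by
  classical
  have h0 := (codebookLaw_mem_stdSimplex (M := M) hq).1
  have h1 : ∀ y, |(codebookCode hM hq g hg).induced x y - g x y * ∏ i, q i (y i)| ≤
      ∑ s, codebookLaw (M := M) q s * ∑ m with (fun i => s i (m i)) = y,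
        |encoder hM (g x) s m - messageWeight (g x) s m| := by
    intro y
    rw [codebookCode_induced, ← sum_codebookLaw_mul_freq hM hq, ← Finset.sum_sub_distrib]
    refine (Finset.abs_sum_le_sum_abs _ _).trans (Finset.sum_le_sum fun s _ => ?_)
    rw [← mul_sub, abs_mul, abs_of_nonneg (h0 s), ← sum_messageWeight_fiber,
      ← Finset.sum_sub_distrib]
    exact mul_le_mul_of_nonneg_left (Finset.abs_sum_le_sum_abs _ _) (h0 s)
  refine (Finset.sum_le_sum fun y _ => h1 y).trans (le_of_eq ?_)
  rw [Finset.sum_comm]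
  refine Finset.sum_congr rfl fun s _ => ?_
  rw [← Finset.mul_sum, Finset.sum_fiberwise, sum_abs_encoder_sub hM (hg x)]

/-- One-shot achievability: rates that dominate the largest likelihood ratios of all reduced
channels relative to a product law suffice for simulation. -/
theorem exists_code {X : Type*} (hM : ∀ i, 0 < M i) (hq : ∀ i, q i ∈ stdSimplex ℝ (Z i))
    {V : X → (∀ i, Z i) → ℝ} (hV : IsChannel V) {v : X → (∀ i, Z i) → ℝ} (hv : ∀ x y, 0 ≤ v x y)
    (hvV : ∀ x y, v x y ≤ V x y) {η : ℝ} (hη : ∀ x, 1 - ∑ y, v x y ≤ η)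
    {B : Finset (Fin K) → ℝ} (hB0 : ∀ J, 0 ≤ B J)
    (hB : ∀ x y, v x y ≠ 0 → ∀ J : Finset (Fin K), J.Nonempty →
      reducedChannel J v x (J.restrict y) ≤ B J * ∏ i ∈ J, q i (y i)) :
    ∃ c : SimulationCode X Z M, ∀ x, tvd (c.induced x) (V x) ≤
      (1 / 2) * (√(η ^ 2 + ∑ J : Finset (Fin K) with J.Nonempty, B J / ∏ i ∈ J, (M i : ℝ)) + η) := by
  set g : X → (∀ i, Z i) → ℝ := fun x y => v x y / ∏ i, q i (y i) with hgdef
  have hg : ∀ x y, 0 ≤ g x y := fun x y =>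
    div_nonneg (hv x y) (Finset.prod_nonneg fun i _ => (hq i).1 _)
  have hgv : ∀ x y, g x y * ∏ i, q i (y i) = v x y := by
    intro x y
    by_cases hy : v x y = 0
    · simp [hgdef, hy]
    refine div_mul_cancel₀ _ (Finset.prod_ne_zero_iff.2 fun i _ hi => hy ?_)
    have h1 := hB x y hy {i} (Finset.singleton_nonempty i)
    rw [Finset.prod_singleton, hi, mul_zero] at h1
    rw [reducedChannel_restrict] at h1
    exact le_antisymm ((Finset.single_le_sum (f := v x) (fun y _ => hv x y) (by simp)).trans h1)
      (hv x y)
  classical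
  refine ⟨codebookCode hM hq g hg, fun x => ?_⟩
  have hlaw := codebookLaw_mem_stdSimplex (M := M) hq
  have hm1 : ∑ y, v x y ≤ 1 := (Finset.sum_le_sum fun y _ => hvV x y).trans (hV x).2.le
  have hmean : ∑ s, codebookLaw (M := M) q s * totalWeight (g x) s = ∑ y, v x y := by
    simp_rw [totalWeight_eq, Finset.mul_sum]
    rw [Finset.sum_comm]
    refine Finset.sum_congr rfl fun y _ => ?_
    rw [sum_codebookLaw_mul_freq hM hq, hgv]
  -- With `μ = ∑ y, v x y`, the second moment bound turns `1 - 2 * μ + E[total ^ 2]` into `(1 - μ) ^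
  -- 2` plus the collision sum, and `0 ≤ 1 - μ ≤ η`.
  have h2 : ∑ s, codebookLaw (M := M) q s * (1 - totalWeight (g x) s) ^ 2 ≤
      η ^ 2 + ∑ J : Finset (Fin K) with J.Nonempty, B J / ∏ i ∈ J, (M i : ℝ) := by
    have h3 : ∀ s, codebookLaw (M := M) q s * (1 - totalWeight (g x) s) ^ 2 =
        codebookLaw (M := M) q s - 2 * (codebookLaw (M := M) q s * totalWeight (g x) s) +
          codebookLaw (M := M) q s * totalWeight (g x) s ^ 2 := fun s => by ring
    simp_rw [h3]
    rw [Finset.sum_add_distrib, Finset.sum_sub_distrib, hlaw.2, ← Finset.mul_sum, hmean]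
    have h4 := secondMoment_le hM hq (hv x) hm1 hB0 fun y hy J hJ => by
      have h := hB x y hy J hJ
      rw [reducedChannel_restrict] at h
      convert h
    have h5 := hη x
    nlinarith
  have h6 : ∑ s, codebookLaw (M := M) q s * |1 - totalWeight (g x) s| ≤
      √(η ^ 2 + ∑ J : Finset (Fin K) with J.Nonempty, B J / ∏ i ∈ J, (M i : ℝ)) := by
    refine Real.le_sqrt_of_sq_le (le_trans ?_ h2)
    -- Cauchy–Schwarz passes from the mean square to the mean absolute deviation.
    have h7 := Finset.sum_sq_le_sum_mul_sum_of_sq_le_mul Finset.univ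
      (r := fun s => codebookLaw (M := M) q s * |1 - totalWeight (g x) s|)
      (f := fun s => codebookLaw (M := M) q s)
      (g := fun s => codebookLaw (M := M) q s * (1 - totalWeight (g x) s) ^ 2)
      (fun s _ => hlaw.1 s) (fun s _ => mul_nonneg (hlaw.1 s) (sq_nonneg _))
      (fun s _ => le_of_eq (by rw [mul_pow, sq_abs]; ring))
    rwa [hlaw.2, one_mul] at h7
  have h8 := sum_abs_codebookCode_induced_sub_le hM hq g hg x
  simp_rw [hgv] at h8
  have h9 : ∑ y, |v x y - V x y| ≤ η := by
    have : ∀ y, |v x y - V x y| = V x y - v x y := fun y => by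
      rw [abs_sub_comm, abs_of_nonneg (sub_nonneg.2 (hvV x y))]
    simp_rw [this]
    rw [Finset.sum_sub_distrib, (hV x).2]
    exact hη x
  unfold tvd
  refine mul_le_mul_of_nonneg_left ?_ (by norm_num)
  refine le_trans ?_ (add_le_add (h8.trans h6) h9)
  rw [← Finset.sum_add_distrib]
  exact Finset.sum_le_sum fun y _ => abs_sub_le _ _ _

end OneShot

/-! ### Types of input words -/

section Types

variable {X : Type*} [Fintype X]

open Classical in
/-- The empirical distribution (the type) of a word. -/
def empirical {n : ℕ} (x : Fin n → X) (a : X) : ℝ :=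
  (n : ℝ)⁻¹ * ∑ t, if x t = a then 1 else 0

theorem sum_comp_eq_mul_sum_empirical {n : ℕ} (hn : 0 < n) (x : Fin n → X) (h : X → ℝ) :
    ∑ t, h (x t) = n * ∑ a, empirical x a * h a := by
  classical
  have hn' : (n : ℝ) ≠ 0 := by positivity
  unfold empirical
  simp_rw [mul_assoc, ← Finset.mul_sum, mul_inv_cancel_left₀ hn', Finset.sum_mul]
  rw [Finset.sum_comm]
  simp

theorem empirical_mem_stdSimplex {n : ℕ} (hn : 0 < n) (x : Fin n → X) :
    empirical x ∈ stdSimplex ℝ X := by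
  refine ⟨fun a => by unfold empirical; positivity, ?_⟩
  have h := sum_comp_eq_mul_sum_empirical hn x fun _ => 1
  have hn' : (n : ℝ) ≠ 0 := by positivity
  simp only [Finset.sum_const, Finset.card_univ, Fintype.card_fin, nsmul_eq_mul, mul_one] at h
  field_simp at h
  exact h.symm

omit [Fintype X] in
theorem inv_le_empirical {n : ℕ} (x : Fin n → X) (t : Fin n) : (n : ℝ)⁻¹ ≤ empirical x (x t) := by
  classical
  unfold empirical
  refine le_mul_of_one_le_right (by positivity) ?_
  refine le_trans (by simp) (Finset.single_le_sum (f := fun u => if x u = x t then (1 : ℝ) else 0)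
    (fun u _ => by positivity) (Finset.mem_univ t))

open Classical in
def empiricals (X : Type*) [Fintype X] (n : ℕ) : Finset (X → ℝ) :=
  Finset.univ.image fun x : Fin n → X => empirical x

/-- A type is determined by its letter counts, each in `{0, …, n}`. Being polynomial, the number of
types does not affect rates. -/
theorem card_empiricals_le (n : ℕ) :
    (empiricals X n).card ≤ (n + 1) ^ Fintype.card X := by
  classical
  have h : empiricals X n ⊆
      Finset.univ.image fun (c : X → Fin (n + 1)) (a : X) => (n : ℝ)⁻¹ * (c a : ℕ) := by
    intro p hp
    obtain ⟨x, -, rfl⟩ := Finset.mem_image.1 hp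
    refine Finset.mem_image.2 ⟨fun a => ⟨(Finset.univ.filter fun t => x t = a).card, ?_⟩,
      Finset.mem_univ _, ?_⟩
    · exact Nat.lt_succ_of_le ((Finset.card_le_univ _).trans (by simp))
    · funext a
      simp [empirical]
  refine (Finset.card_le_card h).trans (Finset.card_image_le.trans ?_)
  simp

end Types

/-! ### Memoryless extensions and reduction to single inputs -/

section Power

variable {K : ℕ} {X : Type*} {Y : Fin K → Type*} [∀ i, Fintype (Y i)]

theorem sum_pi_swap {ι : Type*} [Fintype ι] [DecidableEq ι] {Y : ι → Type*} [∀ i, Fintype (Y i)]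
    {n : ℕ} (F : (∀ i, Fin n → Y i) → ℝ) :
    ∑ y, F y = ∑ a : Fin n → ∀ i, Y i, F (fun i t => a t i) :=
  (Equiv.sum_comp (Equiv.piComm fun (_ : Fin n) i => Y i) F).symm

theorem isChannel_powerChannel {W : X → (∀ i, Y i) → ℝ} (hW : IsChannel W) (n : ℕ) :
    IsChannel (powerChannel n W) := by
  intro x
  refine ⟨fun y => Finset.prod_nonneg fun t _ => (hW (x t)).1 _, ?_⟩
  rw [sum_pi_swap]
  exact (prod_mem_stdSimplex fun t => hW (x t)).2

theorem reducedChannel_powerChannel (J : Finset (Fin K)) (W : X → (∀ i, Y i) → ℝ) {n : ℕ}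
    (x : Fin n → X) (z : ∀ j : J, Fin n → Y j) :
    reducedChannel J (powerChannel n W) x z = ∏ t, reducedChannel J W (x t) fun j => z j t := by
  classical
  unfold reducedChannel
  rw [Finset.prod_univ_sum]
  refine Finset.sum_equiv (Equiv.piComm fun i (_ : Fin n) => Y i) (fun y => ?_) fun y _ => rfl
  simp only [Finset.mem_filter, Finset.mem_univ, true_and, Fintype.mem_piFinset]
  constructor
  · rintro rfl t
    rfl
  · intro h
    funext j t
    exact congrFun (h t) j

theorem tvd_jointLaw {X B : Type*} [Fintype B] [Fintype X] {p : X → ℝ} (hp : p ∈ stdSimplex ℝ X)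
    (U V : X → B → ℝ) :
    tvd (Function.uncurry (jointLaw p U)) (Function.uncurry (jointLaw p V)) =
      ∑ x, p x * tvd (U x) (V x) := by
  unfold tvd
  rw [Fintype.sum_prod_type, Finset.mul_sum]
  refine Finset.sum_congr rfl fun x _ => ?_
  simp_rw [Function.uncurry_apply_pair, jointLaw, ← mul_sub, abs_mul, abs_of_nonneg (hp.1 x)]
  rw [← Finset.mul_sum]
  ring

theorem attainable_of_forall_tvd_le [Fintype X] {ε : ℝ} {V : X → (∀ i, Y i) → ℝ} {M : Fin K → ℕ}
    (c : SimulationCode X Y M) (h : ∀ x, tvd (c.induced x) (V x) ≤ ε) : Attainable ε V M := by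
  refine ⟨c, fun p hp => ?_⟩
  rw [tvd_jointLaw hp]
  calc _ ≤ ∑ x, p x * ε := Finset.sum_le_sum fun x _ => mul_le_mul_of_nonneg_left (h x) (hp.1 x)
    _ = ε := by rw [← Finset.sum_mul, hp.2, one_mul]

end Power

/-! ### Universal codebooks, typical outputs and achievable rates -/

section Achievability

variable {K : ℕ} {X : Type*} [Fintype X] {Y : Fin K → Type*} [∀ i, Fintype (Y i)]

/-- The mixture, over all types, of the product laws that output `i` has under them. -/
def typeMixture (W : X → (∀ i, Y i) → ℝ) (n : ℕ) (i : Fin K) (z : Fin n → Y i) : ℝ :=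
  ((empiricals X n).card : ℝ)⁻¹ *
    ∑ p ∈ empiricals X n, ∏ t, outputMarginal (jointLaw p W) i (z t)

variable {W : X → (∀ i, Y i) → ℝ}

theorem mem_stdSimplex_of_mem_empiricals {n : ℕ} (hn : 0 < n) {p : X → ℝ}
    (hp : p ∈ empiricals X n) : p ∈ stdSimplex ℝ X := by
  classical
  obtain ⟨x, -, rfl⟩ := Finset.mem_image.1 hp
  exact empirical_mem_stdSimplex hn x

theorem empirical_mem_empiricals {n : ℕ} (x : Fin n → X) : empirical x ∈ empiricals X n := by
  classical
  exact Finset.mem_image_of_mem _ (Finset.mem_univ x)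

theorem typeMixture_mem_stdSimplex [Nonempty X] (hW : IsChannel W) {n : ℕ} (hn : 0 < n)
    (i : Fin K) : typeMixture W n i ∈ stdSimplex ℝ (Fin n → Y i) := by
  have h : ∀ p ∈ empiricals X n,
      (fun z : Fin n → Y i => ∏ t, outputMarginal (jointLaw p W) i (z t)) ∈ stdSimplex ℝ _ :=
    fun p hp => prod_mem_stdSimplex fun _ =>
      outputMarginal_mem_stdSimplex (mem_stdSimplex_of_mem_empiricals hn hp) hW i
  refine ⟨fun z => mul_nonneg (by positivity) (Finset.sum_nonneg fun p hp => (h p hp).1 z), ?_⟩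
  unfold typeMixture
  rw [← Finset.mul_sum, Finset.sum_comm, Finset.sum_congr rfl fun p hp => (h p hp).2]
  have : (empiricals X n).card ≠ 0 :=
    Finset.card_ne_zero.2 ⟨_, empirical_mem_empiricals fun _ => Classical.arbitrary X⟩
  simp [this]

/-- Keep only the term of the mixture that belongs to the type of `x`; its weight is the reciprocal
of the number of types. -/
theorem prod_outputMarginal_le_typeMixture (hW : IsChannel W) {n : ℕ} (hn : 0 < n)
    (x : Fin n → X) (i : Fin K) (z : Fin n → Y i) :
    ∏ t, outputMarginal (jointLaw (empirical x) W) i (z t) ≤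
      ((n : ℝ) + 1) ^ Fintype.card X * typeMixture W n i z := by
  have h0 : ∀ p ∈ empiricals X n, 0 ≤ ∏ t, outputMarginal (jointLaw p W) i (z t) :=
    fun p hp => Finset.prod_nonneg fun t _ =>
      (outputMarginal_mem_stdSimplex (mem_stdSimplex_of_mem_empiricals hn hp) hW i).1 _
  have h1 := Finset.single_le_sum (f := fun p => ∏ t, outputMarginal (jointLaw p W) i (z t)) h0
    (empirical_mem_empiricals x)
  have h2 : (0 : ℝ) < (empiricals X n).card := by
    exact_mod_cast Finset.card_pos.2 ⟨_, empirical_mem_empiricals x⟩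
  have h3 : ((empiricals X n).card : ℝ) ≤ ((n : ℝ) + 1) ^ Fintype.card X := by
    exact_mod_cast card_empiricals_le (X := X) n
  refine h1.trans ?_
  unfold typeMixture
  rw [← mul_assoc]
  refine le_mul_of_one_le_left (Finset.sum_nonneg h0) ?_
  rw [← div_eq_mul_inv, le_div_iff₀ h2, one_mul]
  exact h3

theorem exists_le_of_ne_zero (hW : IsChannel W) :
    ∃ w : ℝ, 0 < w ∧ w ≤ 1 ∧ ∀ x y, W x y ≠ 0 → w ≤ W x y := by
  classical
  -- Adding 1 makes the set nonempty and gives `w ≤ 1`.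
  set s : Finset ℝ := insert 1 ((Finset.univ.image (Function.uncurry W)).filter fun a => a ≠ 0)
  have hs : s.Nonempty := ⟨1, Finset.mem_insert_self _ _⟩
  refine ⟨s.min' hs, (Finset.lt_min'_iff _ _).2 fun a ha => ?_,
    Finset.min'_le _ _ (Finset.mem_insert_self _ _), fun x y h => Finset.min'_le _ _ ?_⟩
  · rcases Finset.mem_insert.1 ha with rfl | ha
    · exact one_pos
    · obtain ⟨h1, h2⟩ := Finset.mem_filter.1 ha
      obtain ⟨⟨x, y⟩, -, rfl⟩ := Finset.mem_image.1 h1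
      exact lt_of_le_of_ne ((hW x).1 y) (Ne.symm h2)
  · exact Finset.mem_insert_of_mem (Finset.mem_filter.2
      ⟨Finset.mem_image.2 ⟨(x, y), Finset.mem_univ _, rfl⟩, h⟩)

omit [Fintype X] in
theorem le_reducedChannel (hW : IsChannel W) (J : Finset (Fin K)) (x : X) (y : ∀ i, Y i) :
    W x y ≤ reducedChannel J W x (J.restrict y) := by
  classical
  rw [reducedChannel_restrict]
  exact Finset.single_le_sum (f := W x) (fun y _ => (hW x).1 y) (by simp)

/-- A letter that occurs in `x` has frequency at least `1 / n`, so the marginals lie in `[w / n, 1]`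
and the reduced channel in `[w, 1]`. The density is therefore between `-logb 2 (n / w)` and `J.card
* logb 2 (n / w)`; `1 ≤ J.card ≤ K` covers both signs. -/
theorem abs_infoDensity_le (hW : IsChannel W) {w : ℝ} (hw0 : 0 < w) (hw1 : w ≤ 1)
    (hw : ∀ x y, W x y ≠ 0 → w ≤ W x y) {J : Finset (Fin K)} (hJ : J.Nonempty) {n : ℕ}
    (hn : 0 < n) (x : Fin n → X) (t : Fin n) {y : ∀ i, Y i} (hy : W (x t) y ≠ 0) :
    |infoDensity J W (empirical x) (x t) y| ≤ K * Real.logb 2 (n / w) := by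
  have hn' : (1 : ℝ) ≤ n := by exact_mod_cast hn
  have hp := empirical_mem_stdSimplex hn x
  have h1 : w ≤ reducedChannel J W (x t) (J.restrict y) :=
    (hw _ _ hy).trans (le_reducedChannel hW J _ _)
  have h2 : reducedChannel J W (x t) (J.restrict y) ≤ 1 := by
    have h := isChannel_reducedChannel J hW (x t)
    rw [← h.2]
    exact Finset.single_le_sum (fun z _ => h.1 z) (Finset.mem_univ _)
  have h3 : ∀ i, w / n ≤ outputMarginal (jointLaw (empirical x) W) i (y i) := by
    intro i
    refine le_trans ?_ (le_outputMarginal (jointLaw_nonneg hp hW) i (x t) y)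
    rw [div_eq_inv_mul]
    exact mul_le_mul (inv_le_empirical x t) (hw _ _ hy) hw0.le (hp.1 _)
  have h4 : ∀ i, outputMarginal (jointLaw (empirical x) W) i (y i) ≤ 1 := by
    intro i
    have h := outputMarginal_mem_stdSimplex hp hW i
    rw [← h.2]
    exact Finset.single_le_sum (fun z _ => h.1 z) (Finset.mem_univ _)
  have hwn : 0 < w / n := by positivity
  have h5 : ∀ i, 0 < outputMarginal (jointLaw (empirical x) W) i (y i) := fun i =>
    hwn.trans_le (h3 i)
  have hL : Real.logb 2 (w / n) = - Real.logb 2 (n / w) := by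
    rw [← Real.logb_inv, inv_div]
  have hL0 : 0 ≤ Real.logb 2 (n / w) := by
    refine Real.logb_nonneg (by norm_num) ?_
    rw [le_div_iff₀ hw0]
    linarith
  have h6 : Real.logb 2 (∏ i ∈ J, outputMarginal (jointLaw (empirical x) W) i (y i)) =
      ∑ i ∈ J, Real.logb 2 (outputMarginal (jointLaw (empirical x) W) i (y i)) :=
    Real.logb_prod _ _ fun i _ => (h5 i).ne'
  have h7 : ∑ i ∈ J, Real.logb 2 (outputMarginal (jointLaw (empirical x) W) i (y i)) ≤ 0 :=
    Finset.sum_nonpos fun i _ => Real.logb_nonpos (by norm_num) (h5 i).le (h4 i)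
  have h8 : -(J.card * Real.logb 2 (n / w)) ≤
      ∑ i ∈ J, Real.logb 2 (outputMarginal (jointLaw (empirical x) W) i (y i)) := by
    rw [← mul_neg, ← hL, ← nsmul_eq_mul]
    exact Finset.card_nsmul_le_sum _ _ _ fun i _ =>
      Real.logb_le_logb_of_le (by norm_num) hwn (h3 i)
  have h9 : Real.logb 2 (reducedChannel J W (x t) (J.restrict y)) ≤ 0 :=
    Real.logb_nonpos (by norm_num) (hw0.le.trans h1) h2
  have h10 : - Real.logb 2 (n / w) ≤ Real.logb 2 (reducedChannel J W (x t) (J.restrict y)) := by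
    rw [← hL]
    exact Real.logb_le_logb_of_le (by norm_num) hwn ((div_le_self hw0.le hn').trans h1)
  have hc1 : (J.card : ℝ) * Real.logb 2 (n / w) ≤ K * Real.logb 2 (n / w) := by
    refine mul_le_mul_of_nonneg_right ?_ hL0
    exact_mod_cast (Finset.card_le_univ J).trans_eq (Fintype.card_fin K)
  have hc2 : 1 * Real.logb 2 (n / w) ≤ J.card * Real.logb 2 (n / w) := by
    refine mul_le_mul_of_nonneg_right ?_ hL0
    exact_mod_cast hJ.card_pos
  rw [infoDensity, Real.logb_div (hw0.trans_le h1).ne' (Finset.prod_ne_zero_iff.2 fun i _ =>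
    (h5 i).ne'), h6, abs_le]
  constructor <;> linarith

theorem rpow_infoDensity_mul (hW : IsChannel W) (J : Finset (Fin K)) {p : X → ℝ}
    (hp : p ∈ stdSimplex ℝ X) {x : X} (hx : p x ≠ 0) {y : ∀ i, Y i} (hy : W x y ≠ 0) :
    reducedChannel J W x (J.restrict y) = (2 : ℝ) ^ infoDensity J W p x y *
      ∏ i ∈ J, outputMarginal (jointLaw p W) i (y i) := by
  have h1 : 0 < W x y := lt_of_le_of_ne ((hW x).1 y) (Ne.symm hy)
  have h2 : 0 < p x := lt_of_le_of_ne (hp.1 x) (Ne.symm hx)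
  have h3 : 0 < ∏ i ∈ J, outputMarginal (jointLaw p W) i (y i) := Finset.prod_pos fun i _ =>
    (mul_pos h2 h1).trans_le (le_outputMarginal (jointLaw_nonneg hp hW) i x y)
  rw [infoDensity, Real.rpow_logb (by norm_num) (by norm_num)
    (div_pos (h1.trans_le (le_reducedChannel hW J x y)) h3), div_mul_cancel₀ _ h3.ne']

/-- The log-likelihood ratio of words, relative to the type of the input word. -/
def wordDensity (W : X → (∀ i, Y i) → ℝ) (J : Finset (Fin K)) {n : ℕ} (x : Fin n → X)
    (y : ∀ i, Fin n → Y i) : ℝ :=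
  ∑ t, infoDensity J W (empirical x) (x t) fun i => y i t

theorem reducedChannel_powerChannel_le (hW : IsChannel W) (J : Finset (Fin K)) {n : ℕ}
    (hn : 0 < n) (x : Fin n → X) {y : ∀ i, Fin n → Y i} (hy : powerChannel n W x y ≠ 0) :
    reducedChannel J (powerChannel n W) x (J.restrict y) ≤ (2 : ℝ) ^ wordDensity W J x y *
      (((n : ℝ) + 1) ^ Fintype.card X) ^ J.card * ∏ i ∈ J, typeMixture W n i (y i) := by
  have hp := empirical_mem_stdSimplex hn x
  have h1 : reducedChannel J (powerChannel n W) x (J.restrict y) =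
      ∏ t, reducedChannel J W (x t) (J.restrict fun i => y i t) :=
    reducedChannel_powerChannel J W x _
  have h2 : ∀ t, reducedChannel J W (x t) (J.restrict fun i => y i t) = _ := fun t =>
    rpow_infoDensity_mul hW J hp
      ((inv_pos.2 (Nat.cast_pos.2 hn)).trans_le (inv_le_empirical x t)).ne'
      (Finset.prod_ne_zero_iff.1 hy t (Finset.mem_univ t))
  simp_rw [h1, h2]
  rw [Finset.prod_mul_distrib, ← Real.rpow_sum_of_pos (by norm_num), Finset.prod_comm, mul_assoc]
  refine mul_le_mul_of_nonneg_left ?_ (by positivity)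
  rw [← Finset.prod_const, ← Finset.prod_mul_distrib]
  exact Finset.prod_le_prod (fun i _ => Finset.prod_nonneg fun t _ =>
    (outputMarginal_mem_stdSimplex hp hW i).1 _) fun i _ =>
      prod_outputMarginal_le_typeMixture hW hn x i (y i)

open Classical in
-- Since the density refers to the type of `x` itself, its mean given `x` is `n` times the
-- information at that type, hence at most `n * C̃`. Chebyshev then gives a bound uniform in `x`.
theorem sum_powerChannel_wordDensity_gt_le [Nonempty X] (hW : IsChannel W) {w : ℝ} (hw0 : 0 < w)
    (hw1 : w ≤ 1) (hw : ∀ x y, W x y ≠ 0 → w ≤ W x y) {J : Finset (Fin K)} (hJ : J.Nonempty)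
    {n : ℕ} (hn : 0 < n) {δ : ℝ} (hδ : 0 < δ) (x : Fin n → X) :
    ∑ y with n * (multiCapacity (reducedChannel J W) + δ) < wordDensity W J x y,
      powerChannel n W x y ≤ n * (K * Real.logb 2 (n / w)) ^ 2 / (n * δ) ^ 2 := by
  have hn' : (0 : ℝ) < n := by exact_mod_cast hn
  have hp := empirical_mem_stdSimplex hn x
  have h1 := chebyshev_pi (P := fun t => W (x t)) (fun t => hW (x t))
    (fun t => infoDensity J W (empirical x) (x t)) (B := K * Real.logb 2 (n / w))
    (fun t y hy => abs_infoDensity_le hW hw0 hw1 hw hJ hn x t hy) (mul_pos hn' hδ)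
  rw [Fintype.card_fin] at h1
  refine le_trans ?_ h1
  have h2 : ∑ t, ∑ y, W (x t) y * infoDensity J W (empirical x) (x t) y ≤
      n * multiCapacity (reducedChannel J W) := by
    rw [sum_comp_eq_mul_sum_empirical hn x fun a => ∑ y, W a y * infoDensity J W (empirical x) a y,
      ← multiInfo_reducedChannel hW]
    exact mul_le_mul_of_nonneg_left
      ((isGreatest_multiCapacity (isChannel_reducedChannel J hW)).2 ⟨_, hp, rfl⟩) hn'.le
  rw [Finset.sum_filter, sum_pi_swap, Finset.sum_filter]
  refine Finset.sum_le_sum fun a _ => ?_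
  have h3 : 0 ≤ ∏ t, W (x t) (a t) := Finset.prod_nonneg fun t _ => (hW _).1 _
  split_ifs with h h' h'
  · exact le_rfl
  · refine absurd (le_trans ?_ (le_abs_self _)) h'
    have h4 : wordDensity W J x (fun i t => a t i) =
      ∑ t, infoDensity J W (empirical x) (x t) (a t) := rfl
    rw [h4] at h
    linarith
  · exact h3
  · exact le_rfl

/-- The density bound grows only logarithmically, and `log ^ 2 u / u → 0` with `u = n / w`. -/
theorem tendsto_typicality_error (c δ : ℝ) {w : ℝ} (hw : 0 < w) (hδ : 0 < δ) :
    Filter.Tendsto (fun n : ℕ => (n : ℝ) * (c * Real.logb 2 (n / w)) ^ 2 / (n * δ) ^ 2)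
      Filter.atTop (nhds 0) := by
  have h1 : Filter.Tendsto (fun n : ℕ => (n : ℝ) / w) Filter.atTop Filter.atTop :=
    tendsto_natCast_atTop_atTop.atTop_div_const hw
  have h2 := ((Real.isLittleO_pow_log_id_atTop (n := 2)).tendsto_div_nhds_zero.comp h1).const_mul
    (c ^ 2 / (Real.log 2 ^ 2 * w * δ ^ 2))
  rw [mul_zero] at h2
  refine h2.congr' ?_
  filter_upwards [Filter.eventually_gt_atTop 0] with n hn
  have hn' : (n : ℝ) ≠ 0 := by positivity
  have : Real.log 2 ≠ 0 := (Real.log_pos (by norm_num)).ne'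
  simp only [Function.comp, id, Real.logb]
  field_simp

theorem tendsto_poly_mul_rpow_neg (c : ℝ) (k : ℕ) {δ : ℝ} (hδ : 0 < δ) :
    Filter.Tendsto (fun n : ℕ => c * (((n : ℝ) + 1) ^ k * (2 : ℝ) ^ (-(n * δ))))
      Filter.atTop (nhds 0) := by
  have h0 : (0 : ℝ) < 2 ^ (-δ) := by positivity
  have h1 : |(2 : ℝ) ^ (-δ)| < 1 := by
    rw [abs_of_pos h0]
    exact Real.rpow_lt_one_of_one_lt_of_neg (by norm_num) (by linarith)
  -- The limit is taken along `n + 1` to match the polynomial; the factor `(2 ^ (-δ))⁻¹` undoes the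
  -- shift in the exponential.
  have h2 := (((tendsto_pow_const_mul_const_pow_of_abs_lt_one k h1).comp
    (Filter.tendsto_add_atTop_nat 1)).const_mul ((2 ^ (-δ))⁻¹)).const_mul c
  rw [mul_zero, mul_zero] at h2
  refine h2.congr fun n => ?_
  have h3 : (2 : ℝ) ^ (-(n * δ)) = (2 ^ (-δ)) ^ n := by
    rw [← Real.rpow_natCast, ← Real.rpow_mul (by norm_num)]
    ring_nf
  simp only [Function.comp]
  rw [h3, pow_succ]
  push_cast
  field_simp

open Classical in
/-- The reduced message sizes dominate the likelihood ratios of typical words. -/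
theorem sum_div_prod_floor_le {C : Finset (Fin K) → ℝ} {r : Fin K → ℝ} (hr : ∀ i, 0 ≤ r i) {δ : ℝ}
    (hC : ∀ J : Finset (Fin K), J.Nonempty → C J + 2 * δ ≤ ∑ i ∈ J, r i) (a n : ℕ) :
    ∑ J : Finset (Fin K) with J.Nonempty, ((2 : ℝ) ^ (n * (C J + δ)) *
        (((n : ℝ) + 1) ^ a) ^ J.card) / ∏ i ∈ J, ((⌊(2 : ℝ) ^ ((n : ℝ) * r i)⌋₊ : ℕ) : ℝ) ≤
      (2 ^ K * 2 ^ K) * (((n : ℝ) + 1) ^ (a * K) * (2 : ℝ) ^ (-(n * δ))) := by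
  have h1 : ∀ J : Finset (Fin K), J.Nonempty → ((2 : ℝ) ^ (n * (C J + δ)) *
        (((n : ℝ) + 1) ^ a) ^ J.card) / ∏ i ∈ J, ((⌊(2 : ℝ) ^ ((n : ℝ) * r i)⌋₊ : ℕ) : ℝ) ≤
      2 ^ K * (((n : ℝ) + 1) ^ (a * K) * (2 : ℝ) ^ (-(n * δ))) := by
    intro J hJ
    have hcard : J.card ≤ K := (Finset.card_le_univ J).trans_eq (Fintype.card_fin K)
    -- Rounding down a number that is at least 1 loses at most a factor 2, hence at most `2 ^ K`
    -- over `J`. The second `2 ^ K` in the bound counts the sets `J`.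
    have h2 : ∀ i, (2 : ℝ) ^ ((n : ℝ) * r i) ≤ 2 * (⌊(2 : ℝ) ^ ((n : ℝ) * r i)⌋₊ : ℕ) := by
      intro i
      have h3 : 1 ≤ (2 : ℝ) ^ ((n : ℝ) * r i) :=
        Real.one_le_rpow (by norm_num) (mul_nonneg (Nat.cast_nonneg _) (hr i))
      have h4 : (1 : ℝ) ≤ (⌊(2 : ℝ) ^ ((n : ℝ) * r i)⌋₊ : ℕ) := by
        exact_mod_cast Nat.le_floor (by exact_mod_cast h3)
      have h5 := Nat.lt_floor_add_one ((2 : ℝ) ^ ((n : ℝ) * r i))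
      linarith
    have h6 : (2 : ℝ) ^ (n * ∑ i ∈ J, r i) ≤
        2 ^ K * ∏ i ∈ J, ((⌊(2 : ℝ) ^ ((n : ℝ) * r i)⌋₊ : ℕ) : ℝ) := by
      rw [Finset.mul_sum, Real.rpow_sum_of_pos (by norm_num)]
      refine (Finset.prod_le_prod (fun i _ => by positivity) fun i _ => h2 i).trans ?_
      rw [Finset.prod_mul_distrib, Finset.prod_const]
      exact mul_le_mul_of_nonneg_right (pow_le_pow_right₀ (by norm_num) hcard) (by positivity)
    have h7 : 0 < ∏ i ∈ J, ((⌊(2 : ℝ) ^ ((n : ℝ) * r i)⌋₊ : ℕ) : ℝ) := by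
      have : (0 : ℝ) < (2 : ℝ) ^ (n * ∑ i ∈ J, r i) := by positivity
      exact pos_of_mul_pos_right (this.trans_le h6) (by positivity)
    rw [div_le_iff₀ h7]
    have h8 : (2 : ℝ) ^ (n * (C J + δ)) ≤
        (2 : ℝ) ^ (n * ∑ i ∈ J, r i) * (2 : ℝ) ^ (-(n * δ)) := by
      rw [← Real.rpow_add (by norm_num)]
      refine Real.rpow_le_rpow_of_exponent_le (by norm_num) ?_
      have := mul_le_mul_of_nonneg_left (hC J hJ) (Nat.cast_nonneg (α := ℝ) n)
      linarith
    have h9 : (((n : ℝ) + 1) ^ a) ^ J.card ≤ ((n : ℝ) + 1) ^ (a * K) := by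
      rw [← pow_mul]
      exact pow_le_pow_right₀ (by simp) (Nat.mul_le_mul_left _ hcard)
    calc _ ≤ (2 ^ K * ∏ i ∈ J, ((⌊(2 : ℝ) ^ ((n : ℝ) * r i)⌋₊ : ℕ) : ℝ)) *
          (2 : ℝ) ^ (-(n * δ)) * ((n : ℝ) + 1) ^ (a * K) := by
          refine mul_le_mul (h8.trans (mul_le_mul_of_nonneg_right h6 (by positivity))) h9
            (by positivity) (by positivity)
      _ = _ := by ring
  refine (Finset.sum_le_card_nsmul _ _ _ fun J hJ => h1 J (Finset.mem_filter.1 hJ).2).trans ?_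
  rw [nsmul_eq_mul, mul_assoc (2 ^ K)]
  refine mul_le_mul_of_nonneg_right ?_ (by positivity)
  exact_mod_cast (Finset.card_le_univ _).trans_eq (by simp)

open Classical in
/-- The channel `W^{⊗ n}`, restricted to output words that are typical for every set of outputs. -/
def typicalPart (W : X → (∀ i, Y i) → ℝ) (δ : ℝ) (n : ℕ) (x : Fin n → X)
    (y : ∀ i, Fin n → Y i) : ℝ :=
  if ∀ J : Finset (Fin K), J.Nonempty →
    wordDensity W J x y ≤ n * (multiCapacity (reducedChannel J W) + δ)
  then powerChannel n W x y else 0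

theorem typicalPart_nonneg (hW : IsChannel W) (δ : ℝ) (n : ℕ) (x : Fin n → X)
    (y : ∀ i, Fin n → Y i) : 0 ≤ typicalPart W δ n x y := by
  unfold typicalPart
  split_ifs
  exacts [(isChannel_powerChannel hW n x).1 y, le_rfl]

theorem typicalPart_le (hW : IsChannel W) (δ : ℝ) (n : ℕ) (x : Fin n → X)
    (y : ∀ i, Fin n → Y i) : typicalPart W δ n x y ≤ powerChannel n W x y := by
  unfold typicalPart
  split_ifs
  exacts [le_rfl, (isChannel_powerChannel hW n x).1 y]

/-- A union bound over the at most `2 ^ K` sets `J` whose typicality condition may fail. -/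
theorem one_sub_sum_typicalPart_le [Nonempty X] (hW : IsChannel W) {w : ℝ} (hw0 : 0 < w)
    (hw1 : w ≤ 1) (hw : ∀ x y, W x y ≠ 0 → w ≤ W x y) {δ : ℝ} (hδ : 0 < δ) {n : ℕ} (hn : 0 < n)
    (x : Fin n → X) : 1 - ∑ y, typicalPart W δ n x y ≤
      2 ^ K * (n * (K * Real.logb 2 (n / w)) ^ 2 / (n * δ) ^ 2) := by
  classical
  have hV := isChannel_powerChannel hW n
  rw [← (hV x).2, ← Finset.sum_sub_distrib]
  have h1 : ∀ y, powerChannel n W x y - typicalPart W δ n x y ≤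
      ∑ J : Finset (Fin K) with J.Nonempty,
        if n * (multiCapacity (reducedChannel J W) + δ) < wordDensity W J x y then
          powerChannel n W x y else 0 := by
    intro y
    have h2 : ∀ J : Finset (Fin K), 0 ≤
        if n * (multiCapacity (reducedChannel J W) + δ) < wordDensity W J x y then
        powerChannel n W x y else 0 := fun J => by
      split_ifs
      exacts [(hV x).1 y, le_rfl]
    unfold typicalPart
    split_ifs with hy
    · rw [sub_self]
      exact Finset.sum_nonneg fun J _ => h2 J
    · rw [sub_zero]
      simp only [not_forall, not_le] at hy
      obtain ⟨J, hJ, hJ'⟩ := hy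
      refine le_trans (le_of_eq ?_) (Finset.single_le_sum (fun J _ => h2 J)
        (Finset.mem_filter.2 ⟨Finset.mem_univ J, hJ⟩))
      rw [if_pos hJ']
  refine (Finset.sum_le_sum fun y _ => h1 y).trans ?_
  rw [Finset.sum_comm]
  simp_rw [← Finset.sum_filter (s := (Finset.univ : Finset (∀ i, Fin n → Y i)))]
  refine (Finset.sum_le_card_nsmul _ _ _ fun J hJ => sum_powerChannel_wordDensity_gt_le hW hw0 hw1
    hw (Finset.mem_filter.1 hJ).2 hn hδ x).trans ?_
  rw [nsmul_eq_mul]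
  refine mul_le_mul_of_nonneg_right ?_ (by positivity)
  exact_mod_cast (Finset.card_le_univ _).trans_eq (by simp)

/-- Truncation only lowers the `J`-marginal, and the full marginal at `y` is controlled by the word
density of `y` itself, which is typical. This is the hypothesis `hB` of `exists_code`. -/
theorem reducedChannel_typicalPart_le [Nonempty X] (hW : IsChannel W) {δ : ℝ} {n : ℕ} (hn : 0 < n)
    (x : Fin n → X) {y : ∀ i, Fin n → Y i} (hy : typicalPart W δ n x y ≠ 0)
    {J : Finset (Fin K)} (hJ : J.Nonempty) :
    reducedChannel J (typicalPart W δ n) x (J.restrict y) ≤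
        ((2 : ℝ) ^ (n * (multiCapacity (reducedChannel J W) + δ)) *
          (((n : ℝ) + 1) ^ Fintype.card X) ^ J.card) * ∏ i ∈ J, typeMixture W n i (y i) := by
  unfold typicalPart at hy
  obtain ⟨hgood, hy'⟩ := ite_ne_right_iff.1 hy
  refine (Finset.sum_le_sum fun y' _ => typicalPart_le hW δ n x y').trans ?_
  refine (reducedChannel_powerChannel_le hW J hn x hy').trans
    (mul_le_mul_of_nonneg_right (mul_le_mul_of_nonneg_right
    (Real.rpow_le_rpow_of_exponent_le (by norm_num) (hgood J hJ)) (by positivity)) ?_)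
  exact Finset.prod_nonneg fun i _ => (typeMixture_mem_stdSimplex hW hn i).1 _

theorem exists_code_powerChannel [Nonempty X] (hW : IsChannel W) {w : ℝ} (hw0 : 0 < w)
    (hw1 : w ≤ 1) (hw : ∀ x y, W x y ≠ 0 → w ≤ W x y) {δ : ℝ} (hδ : 0 < δ) {r : Fin K → ℝ}
    (hr : ∀ i, 0 ≤ r i) (hC : ∀ J : Finset (Fin K), J.Nonempty →
      multiCapacity (reducedChannel J W) + 2 * δ ≤ ∑ i ∈ J, r i) {n : ℕ} (hn : 0 < n) :
    ∃ c : SimulationCode (Fin n → X) (fun i => Fin n → Y i)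
      (fun i => ⌊(2 : ℝ) ^ ((n : ℝ) * r i)⌋₊),
      ∀ x, tvd (c.induced x) (powerChannel n W x) ≤ (1 / 2) *
        (√((2 ^ K * (n * (K * Real.logb 2 (n / w)) ^ 2 / (n * δ) ^ 2)) ^ 2 +
          (2 ^ K * 2 ^ K) * (((n : ℝ) + 1) ^ (Fintype.card X * K) * (2 : ℝ) ^ (-(n * δ)))) +
          2 ^ K * (n * (K * Real.logb 2 (n / w)) ^ 2 / (n * δ) ^ 2)) := by
  have hM : ∀ i, 0 < ⌊(2 : ℝ) ^ ((n : ℝ) * r i)⌋₊ := fun i => Nat.floor_pos.2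
    (Real.one_le_rpow (by norm_num) (mul_nonneg (Nat.cast_nonneg _) (hr i)))
  obtain ⟨c, hc⟩ := exists_code hM (typeMixture_mem_stdSimplex hW hn)
    (isChannel_powerChannel hW n) (typicalPart_nonneg hW δ n) (typicalPart_le hW δ n)
    (one_sub_sum_typicalPart_le hW hw0 hw1 hw hδ hn)
    (B := fun J => (2 : ℝ) ^ (n * (multiCapacity (reducedChannel J W) + δ)) *
      (((n : ℝ) + 1) ^ Fintype.card X) ^ J.card)
    (fun J => by positivity) (fun x y hy J hJ => reducedChannel_typicalPart_le hW hn x hy hJ)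
  refine ⟨c, fun x => (hc x).trans ?_⟩
  refine mul_le_mul_of_nonneg_left (add_le_add_left (Real.sqrt_le_sqrt (add_le_add_right ?_ _)) _)
    (by norm_num)
  exact sum_div_prod_floor_le hr hC _ n

theorem exists_forall_attainable [Nonempty X] (hW : IsChannel W) {ε : ℝ} (hε : 0 < ε) {δ : ℝ}
    (hδ : 0 < δ) {r : Fin K → ℝ} (hr : ∀ i, 0 ≤ r i) (hC : ∀ J : Finset (Fin K), J.Nonempty →
      multiCapacity (reducedChannel J W) + 2 * δ ≤ ∑ i ∈ J, r i) :
    ∃ N : ℕ, ∀ n ≥ N,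
      Attainable ε (powerChannel n W) fun i => ⌊(2 : ℝ) ^ ((n : ℝ) * r i)⌋₊ := by
  obtain ⟨w, hw0, hw1, hw⟩ := exists_le_of_ne_zero hW
  have h1 := (tendsto_typicality_error K δ hw0 hδ).const_mul ((2 : ℝ) ^ K)
  have h2 := tendsto_poly_mul_rpow_neg (2 ^ K * 2 ^ K) (Fintype.card X * K) hδ
  have h3 := ((((h1.pow 2).add h2).sqrt).add h1).const_mul (1 / 2 : ℝ)
  have h4 : (1 / 2 : ℝ) * (√((2 ^ K * 0) ^ 2 + 0) + 2 ^ K * 0) < ε := by simpa using hε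
  obtain ⟨N, hN⟩ := Filter.eventually_atTop.1
    ((h3.eventually_lt_const h4).and (Filter.eventually_gt_atTop 0))
  refine ⟨N, fun n hn => ?_⟩
  obtain ⟨c, hc⟩ := exists_code_powerChannel hW hw0 hw1 hw hδ hr hC (hN n hn).2
  exact attainable_of_forall_tvd_le c fun x => (hc x).trans (hN n hn).1.le

end Achievability

/-! ### Induced channels and the one-shot converse -/

section InducedChannel

theorem hasSum_mul_of_nonneg {S T : Type*} {f : S → ℝ} {g : T → ℝ} {a b : ℝ} (hf : HasSum f a)
    (hg : HasSum g b) (hf0 : ∀ s, 0 ≤ f s) (hg0 : ∀ t, 0 ≤ g t) :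
    HasSum (fun u : S × T => f u.1 * g u.2) (a * b) :=
  hf.mul hg (hf.summable.mul_of_nonneg hg.summable hf0 hg0)

/-- Induction splits off the first coordinate; nonnegativity supplies the summability of each
product. This handles shared randomness on infinite alphabets. -/
theorem hasSum_pi_prod : ∀ {K : ℕ} {S : Fin K → Type*} {f : ∀ i, S i → ℝ} {a : Fin K → ℝ},
    (∀ i s, 0 ≤ f i s) → (∀ i, HasSum (f i) (a i)) →
      HasSum (fun s : ∀ i, S i => ∏ i, f i (s i)) (∏ i, a i) := by
  intro K
  induction K with
  | zero =>
    intro S f a _ _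
    simp
  | succ K ih =>
    intro S f a h0 h
    have h1 : HasSum (fun t : ∀ i : Fin K, S i.succ => ∏ i : Fin K, f i.succ (t i))
        (∏ i : Fin K, a i.succ) :=
      ih (S := fun i => S i.succ) (fun i => h0 i.succ) fun i => h i.succ
    have h4 : ∀ t : (∀ i : Fin K, S i.succ), 0 ≤ ∏ i : Fin K, f i.succ (t i) := fun t =>
      Finset.prod_nonneg fun i _ => h0 _ _
    have h2 := hasSum_mul_of_nonneg (h 0) h1 (h0 0) h4
    have h3 : (fun u : S 0 × (∀ i : Fin K, S i.succ) => f 0 u.1 * ∏ i : Fin K, f i.succ (u.2 i)) =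
        (fun s : ∀ i, S i => ∏ i, f i (s i)) ∘ Fin.consEquiv S := by
      funext u
      simp only [Function.comp, Fin.prod_univ_succ]
      rfl
    rw [Fin.prod_univ_succ]
    rw [h3] at h2
    exact (Fin.consEquiv S).hasSum_iff.1 h2

theorem prod_dite_one_eq_prod_coe_sort {ι : Type*} [Fintype ι] [DecidableEq ι] (J : Finset ι) (a : J → ℝ) :
    ∏ i, (if h : i ∈ J then a ⟨i, h⟩ else 1) = ∏ j, a j := by
  rw [← Finset.prod_subset (Finset.subset_univ J), ← Finset.prod_coe_sort J]
  · exact Finset.prod_congr rfl fun j _ => by simp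
  · intro i _ hi
    simp [hi]

open Classical in
-- The fibre is a box, fixed in the coordinates of `J` and free elsewhere, where the factors sum to
-- 1.
theorem sum_fiber_restrict_prod {ι : Type*} [Fintype ι] [DecidableEq ι] {Y : ι → Type*}
    [∀ i, Fintype (Y i)] (J : Finset ι) {d : ∀ i, Y i → ℝ} (hd : ∀ i, ∑ b, d i b = 1)
    (z : ∀ j : J, Y j) :
    ∑ y with J.restrict y = z, ∏ i, d i (y i) = ∏ j : J, d j (z j) := by
  have h1 : (Finset.univ.filter fun y : (∀ i, Y i) => J.restrict y = z) =
      Fintype.piFinset fun i => if h : i ∈ J then {z ⟨i, h⟩} else Finset.univ := by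
    ext y
    simp only [Finset.mem_filter, Finset.mem_univ, true_and, Fintype.mem_piFinset]
    constructor
    · rintro rfl i
      split_ifs <;> simp
    · intro h
      funext j
      simpa using h j
  rw [h1, ← Finset.prod_univ_sum, ← prod_dite_one_eq_prod_coe_sort]
  refine Finset.prod_congr rfl fun i _ => ?_
  split_ifs
  · simp
  · exact hd i

variable {K : ℕ} {X : Type*} {Y : Fin K → Type*} [∀ i, Fintype (Y i)] {M : Fin K → ℕ}

/-- The mass that receiver `i` puts on `b`, averaged over the shared randomness and summed over the
messages. -/
def SimulationCode.decoderMass (c : SimulationCode X Y M) (i : Fin K) (b : Y i) : ℝ :=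
  ∑' s, c.law i s * ∑ m, c.dec i s m b

theorem SimulationCode.dec_le_one (c : SimulationCode X Y M) (i : Fin K) (s : c.S i)
    (m : Fin (M i)) (b : Y i) : c.dec i s m b ≤ 1 := by
  have h := c.dec_isChannel i s m
  rw [← h.2]
  exact Finset.single_le_sum (fun b _ => h.1 b) (Finset.mem_univ b)

theorem SimulationCode.sum_dec_nonneg (c : SimulationCode X Y M) (i : Fin K) (s : c.S i)
    (b : Y i) : 0 ≤ ∑ m, c.dec i s m b :=
  Finset.sum_nonneg fun m _ => (c.dec_isChannel i s m).1 b

theorem SimulationCode.hasSum_decoderMass (c : SimulationCode X Y M) (i : Fin K) (b : Y i) :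
    HasSum (fun s => c.law i s * ∑ m, c.dec i s m b) (c.decoderMass i b) := by
  refine Summable.hasSum (Summable.of_nonneg_of_le
    (fun s => mul_nonneg ((c.law_isPmf i).1 s) (c.sum_dec_nonneg i s b)) (fun s => ?_)
    ((c.law_isPmf i).2.summable.mul_right (M i : ℝ)))
  refine mul_le_mul_of_nonneg_left ?_ ((c.law_isPmf i).1 s)
  refine (Finset.sum_le_sum fun m _ => c.dec_le_one i s m b).trans ?_
  simp

theorem SimulationCode.decoderMass_nonneg (c : SimulationCode X Y M) (i : Fin K) (b : Y i) :
    0 ≤ c.decoderMass i b :=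
  tsum_nonneg fun s => mul_nonneg ((c.law_isPmf i).1 s) (c.sum_dec_nonneg i s b)

/-- Each of the `M i` decoder rows has mass 1. Message sizes enter the converse only here. -/
theorem SimulationCode.sum_decoderMass (c : SimulationCode X Y M) (i : Fin K) :
    ∑ b, c.decoderMass i b = M i := by
  refine HasSum.unique (hasSum_sum fun b _ => c.hasSum_decoderMass i b) ?_
  have h := (c.law_isPmf i).2.mul_right (M i : ℝ)
  rw [one_mul] at h
  refine h.congr_fun fun s => ?_
  rw [← Finset.mul_sum, Finset.sum_comm]
  simp [(c.dec_isChannel i s _).2]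

theorem SimulationCode.hasSum_sum_induced (c : SimulationCode X Y M) (x : X)
    (F : Finset (∀ i, Y i)) :
    HasSum (fun s : (∀ i, c.S i) => (∏ i, c.law i (s i)) *
        ∑ m, c.enc s x m * ∑ y ∈ F, ∏ i, c.dec i (s i) (m i) (y i))
      (∑ y ∈ F, c.induced x y) := by
  have h0 : ∀ s : (∀ i, c.S i), 0 ≤ ∏ i, c.law i (s i) := fun s =>
    Finset.prod_nonneg fun i _ => (c.law_isPmf i).1 _
  have h1 := (hasSum_pi_prod (fun i => (c.law_isPmf i).1) fun i => (c.law_isPmf i).2).summable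
  have h2 : ∀ y, HasSum (fun s : (∀ i, c.S i) => (∏ i, c.law i (s i)) *
      ∑ m, c.enc s x m * ∏ i, c.dec i (s i) (m i) (y i)) (c.induced x y) := by
    intro y
    refine Summable.hasSum (Summable.of_nonneg_of_le (fun s => mul_nonneg (h0 s)
      (Finset.sum_nonneg fun m _ => mul_nonneg ((c.enc_isChannel s x).1 m)
        (Finset.prod_nonneg fun i _ => (c.dec_isChannel i _ _).1 _))) (fun s => ?_) h1)
    refine mul_le_of_le_one_right (h0 s) ?_
    rw [← (c.enc_isChannel s x).2]
    exact Finset.sum_le_sum fun m _ => mul_le_of_le_one_right ((c.enc_isChannel s x).1 m)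
      (Finset.prod_le_one (fun i _ => (c.dec_isChannel i _ _).1 _)
        fun i _ => c.dec_le_one i _ _ _)
  refine (hasSum_sum fun y _ => h2 y).congr_fun fun s => ?_
  rw [← Finset.mul_sum, Finset.sum_comm]
  simp_rw [Finset.mul_sum]

theorem SimulationCode.isChannel_induced (c : SimulationCode X Y M) : IsChannel c.induced := by
  intro x
  refine ⟨fun y => tsum_nonneg fun s => mul_nonneg (Finset.prod_nonneg fun i _ =>
    (c.law_isPmf i).1 _) (Finset.sum_nonneg fun m _ => mul_nonneg ((c.enc_isChannel s x).1 m)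
      (Finset.prod_nonneg fun i _ => (c.dec_isChannel i _ _).1 _)), ?_⟩
  refine (c.hasSum_sum_induced x Finset.univ).unique ?_
  have h := hasSum_pi_prod (fun i => (c.law_isPmf i).1) fun i => (c.law_isPmf i).2
  rw [Finset.prod_const_one] at h
  refine h.congr_fun fun s => ?_
  have h1 : ∀ m : (∀ i, Fin (M i)), ∑ y : (∀ i, Y i), ∏ i, c.dec i (s i) (m i) (y i) = 1 :=
    fun m => (prod_mem_stdSimplex fun i => c.dec_isChannel i (s i) (m i)).2
  simp_rw [h1, mul_one]
  rw [(c.enc_isChannel s x).2, mul_one]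

/-- One-shot converse: a code cannot exceed a product of output masses. -/
theorem SimulationCode.reducedChannel_induced_le (c : SimulationCode X Y M) (J : Finset (Fin K))
    (x : X) (z : ∀ j : J, Y j) :
    reducedChannel J c.induced x z ≤ ∏ j : J, c.decoderMass j (z j) := by
  classical
  let f : ∀ i, c.S i → ℝ := fun i s =>
    c.law i s * if h : i ∈ J then ∑ m, c.dec i s m (z ⟨i, h⟩) else 1
  have hf0 : ∀ i s, 0 ≤ f i s := by
    intro i s
    refine mul_nonneg ((c.law_isPmf i).1 s) ?_
    split_ifs
    exacts [c.sum_dec_nonneg i s _, zero_le_one]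
  have hf : ∀ i, HasSum (f i) (if h : i ∈ J then c.decoderMass i (z ⟨i, h⟩) else 1) := by
    intro i
    by_cases h : i ∈ J
    · simpa only [f, h, dif_pos] using c.hasSum_decoderMass i (z ⟨i, h⟩)
    · simpa only [f, h, not_false_eq_true, dif_neg, mul_one] using (c.law_isPmf i).2
  have h1 := hasSum_pi_prod hf0 hf
  rw [prod_dite_one_eq_prod_coe_sort J fun j => c.decoderMass j (z j)] at h1
  refine hasSum_le (fun s => ?_) (c.hasSum_sum_induced x _) h1
  simp only [f]
  rw [Finset.prod_mul_distrib, prod_dite_one_eq_prod_coe_sort J fun j => ∑ m, c.dec j (s j) m (z j)]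
  refine mul_le_mul_of_nonneg_left ?_ (Finset.prod_nonneg fun i _ => (c.law_isPmf i).1 _)
  -- Replacing the row of the received message by the sum of all rows makes the factor independent
  -- of `m`, so the encoder then sums out to 1.
  have h2 : ∀ m : (∀ i, Fin (M i)), c.enc s x m *
      ∑ y with J.restrict y = z, ∏ i, c.dec i (s i) (m i) (y i) ≤
      c.enc s x m * ∏ j : J, ∑ m, c.dec j (s j) m (z j) := by
    intro m
    refine mul_le_mul_of_nonneg_left ?_ ((c.enc_isChannel s x).1 m)
    rw [sum_fiber_restrict_prod J fun i => (c.dec_isChannel i (s i) (m i)).2]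
    exact Finset.prod_le_prod (fun j _ => (c.dec_isChannel _ _ _).1 _) fun j _ =>
      Finset.single_le_sum (f := fun m => c.dec j (s j) m (z j))
        (fun m _ => (c.dec_isChannel _ _ _).1 _) (Finset.mem_univ (m j))
  refine (Finset.sum_le_sum fun m _ => h2 m).trans (le_of_eq ?_)
  rw [← Finset.sum_mul, (c.enc_isChannel s x).2, one_mul]

end InducedChannel

/-! ### Product-dominated channels on independent inputs -/

section StrongConverse

variable {X : Type*} [Fintype X]
variable {ι : Type*} [Fintype ι] [DecidableEq ι] {Y : ι → Type*} [∀ i, Fintype (Y i)]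

theorem sum_words {n : ℕ} (G : (Fin n → X) → (∀ i, Fin n → Y i) → ℝ) :
    ∑ x, ∑ y, G x y =
      ∑ a : Fin n → X × ∀ i, Y i, G (fun t => (a t).1) fun i t => (a t).2 i := by
  simp_rw [sum_pi_swap (Y := Y)]
  rw [← Fintype.sum_prod_type' (f := fun (x : Fin n → X) (b : Fin n → ∀ i, Y i) =>
    G x fun i t => b t i)]
  exact (Equiv.sum_comp (Equiv.arrowProdEquivProdArrow (Fin n) (fun _ => X) fun _ => ∀ i, Y i)
    fun u => G u.1 fun i t => u.2 t i).symm

theorem jointLaw_mem_stdSimplex {p : X → ℝ} (hp : p ∈ stdSimplex ℝ X) {V : X → (∀ i, Y i) → ℝ}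
    (hV : IsChannel V) : Function.uncurry (jointLaw p V) ∈ stdSimplex ℝ (X × ∀ i, Y i) := by
  refine ⟨fun a => jointLaw_nonneg hp hV a.1 a.2, ?_⟩
  rw [Fintype.sum_prod_type]
  simp_rw [Function.uncurry_apply_pair, jointLaw, ← Finset.mul_sum, (hV _).2, mul_one]
  exact hp.2

/-- The law of the `i`th output word under independent draws is a product of output marginals. -/
theorem sum_prod_jointLaw_mul (p : X → ℝ) (V : X → (∀ i, Y i) → ℝ) {n : ℕ} (i : ι)
    (F : (Fin n → Y i) → ℝ) :
    ∑ a : Fin n → X × ∀ i, Y i, (∏ t, Function.uncurry (jointLaw p V) (a t)) *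
      F (fun t => (a t).2 i) = ∑ z, (∏ t, outputMarginal (jointLaw p V) i (z t)) * F z := by
  classical
  rw [sum_mul_comp _ (fun (a : Fin n → X × ∀ i, Y i) t => (a t).2 i) F]
  refine Finset.sum_congr rfl fun z _ => ?_
  rw [sum_fiber_prod (fun _ : Fin n => Function.uncurry (jointLaw p V)) (fun b => b.2 i) z]
  congr 1
  refine Finset.prod_congr rfl fun t _ => ?_
  rw [Finset.sum_filter, Fintype.sum_prod_type, outputMarginal_eq]
  simp [Function.uncurry_apply_pair]

/-- A word is atypical under the output marginals if the mass `Q` exceeds them exponentially. -/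
theorem sum_prod_jointLaw_exceeds_le {p : X → ℝ} {V : X → (∀ i, Y i) → ℝ} {n : ℕ} (i : ι)
    {Q : (Fin n → Y i) → ℝ} (hQ : ∀ z, 0 ≤ Q z) {m s : ℝ} (hm : 0 < m) (hs : 0 < s)
    (hQm : ∑ z, Q z ≤ m) [DecidablePred fun z : Fin n → Y i =>
      s * m * ∏ t, outputMarginal (jointLaw p V) i (z t) < Q z] :
    ∑ a : Fin n → X × ∀ i, Y i, (∏ t, Function.uncurry (jointLaw p V) (a t)) *
      (if s * m * ∏ t, outputMarginal (jointLaw p V) i ((a t).2 i) < Q (fun t => (a t).2 i)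
        then 1 else 0) ≤ s⁻¹ := by
  rw [sum_prod_jointLaw_mul p V i fun z =>
    if s * m * ∏ t, outputMarginal (jointLaw p V) i (z t) < Q z then 1 else 0]
  -- Markov's inequality: where `Q` exceeds `s * m` times the product law, that law is at most `Q /
  -- (s * m)`.
  have h1 : ∀ z : Fin n → Y i, (∏ t, outputMarginal (jointLaw p V) i (z t)) *
      (if s * m * ∏ t, outputMarginal (jointLaw p V) i (z t) < Q z then 1 else 0) ≤
      (s * m)⁻¹ * Q z := by
    intro z
    split_ifs with h
    · rw [mul_one, ← div_eq_inv_mul, le_div_iff₀ (by positivity), mul_comm]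
      exact h.le
    · rw [mul_zero]
      exact mul_nonneg (by positivity) (hQ z)
  refine (Finset.sum_le_sum fun z _ => h1 z).trans ?_
  rw [← Finset.mul_sum]
  refine (mul_le_mul_of_nonneg_left hQm (by positivity)).trans (le_of_eq ?_)
  field_simp

theorem sum_max_sub_eq_tvd {A : Type*} [Fintype A] {P Q : A → ℝ} (h : ∑ a, P a = ∑ a, Q a) :
    ∑ a, max (P a - Q a) 0 = tvd Q P := by
  have h1 : ∀ a, max (P a - Q a) 0 = (1 / 2) * (|Q a - P a| + (P a - Q a)) := by
    intro a
    rw [abs_sub_comm]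
    rcases le_total 0 (P a - Q a) with h | h
    · rw [max_eq_left h, abs_of_nonneg h]
      ring
    · rw [max_eq_right h, abs_of_nonpos h]
      ring
  simp_rw [h1]
  rw [← Finset.mul_sum, Finset.sum_add_distrib, Finset.sum_sub_distrib, h, sub_self, add_zero]
  rfl

/-- If a channel `T` on words is dominated by a product of masses of total rate below the
multipartite information, then it is far from `V^{⊗ n}` on independent inputs. -/
theorem one_le_of_le_prod {p : X → ℝ} (hp : p ∈ stdSimplex ℝ X) {V : X → (∀ i, Y i) → ℝ}
    (hV : IsChannel V) {B : ℝ}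
    (hB : ∀ x y, |Real.logb 2 (V x y / ∏ i, outputMarginal (jointLaw p V) i (y i))| ≤ B)
    {R δ : ℝ} (hδ : 0 < δ) (hR : R + (Fintype.card ι + 2) * δ ≤ multiInfo (jointLaw p V))
    {n : ℕ} (hn : 0 < n) {T : (Fin n → X) → (∀ i, Fin n → Y i) → ℝ} (hT : IsChannel T)
    {Q : ∀ i, (Fin n → Y i) → ℝ} (hQ : ∀ i z, 0 ≤ Q i z) {m : ι → ℝ} (hm : ∀ i, 0 < m i)
    (hQm : ∀ i, ∑ z, Q i z ≤ m i) (hmR : ∏ i, m i ≤ (2 : ℝ) ^ (n * R))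
    (hTQ : ∀ x y, T x y ≤ ∏ i, Q i (y i)) {ε : ℝ}
    (hε : ∑ x : Fin n → X, (∏ t, p (x t)) *
      tvd (T x) (fun y => ∏ t, V (x t) fun i => y i t) ≤ ε) :
    1 ≤ n * B ^ 2 / (n * δ) ^ 2 + (Fintype.card ι + 1) * (2 : ℝ) ^ (-(n * δ)) + ε := by
  classical
  have hn' : (0 : ℝ) < n := by exact_mod_cast hn
  set r : ∀ i, Y i → ℝ := fun i => outputMarginal (jointLaw p V) i with hr
  set P : X × (∀ i, Y i) → ℝ := Function.uncurry (jointLaw p V) with hP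
  set f : X × (∀ i, Y i) → ℝ := fun b => Real.logb 2 (V b.1 b.2 / ∏ i, r i (b.2 i)) with hf
  set s : ℝ := (2 : ℝ) ^ (n * δ) with hs
  have hPs := jointLaw_mem_stdSimplex hp hV
  have hPn : ∀ a : Fin n → X × ∀ i, Y i, 0 ≤ ∏ t, P (a t) := fun a =>
    Finset.prod_nonneg fun t _ => hPs.1 _
  have hmean : ∑ b, P b * f b = multiInfo (jointLaw p V) := by
    rw [multiInfo_jointLaw hV, Fintype.sum_prod_type]
    simp_rw [Finset.mul_sum, ← mul_assoc]
    rfl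
  have h1 := chebyshev_pi (P := fun _ : Fin n => P) (fun _ => hPs) (fun _ => f) (B := B)
    (fun _ b _ => hB b.1 b.2) (mul_pos hn' hδ)
  simp only [hmean, Finset.sum_const, Finset.card_univ, Fintype.card_fin, nsmul_eq_mul] at h1
  have h2 := fun i => sum_prod_jointLaw_exceeds_le (p := p) (V := V) i (hQ i) (hm i)
    (s := s) (by positivity) (hQm i)
  -- Three cases cover each pair of words: an atypical information density, some `Q i` too large, or
  -- else `T ≤ s⁻¹ * V^{⊗ n}`, so that all but a fraction `s⁻¹` of the mass counts towards the total
  -- variation.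
  have hpoint : ∀ a : Fin n → X × ∀ i, Y i, ∏ t, P (a t) ≤
      (if n * δ ≤ |∑ t, f (a t) - n * multiInfo (jointLaw p V)| then ∏ t, P (a t) else 0) +
      ∑ i, (∏ t, P (a t)) * (if s * m i * ∏ t, r i ((a t).2 i) < Q i (fun t => (a t).2 i)
        then 1 else 0) +
      ((∏ t, p (a t).1) * max ((∏ t, V (a t).1 (a t).2) -
        T (fun t => (a t).1) (fun i t => (a t).2 i)) 0 + s⁻¹ * ∏ t, P (a t)) := by
    intro a
    have hsplit : ∏ t, P (a t) = (∏ t, p (a t).1) * ∏ t, V (a t).1 (a t).2 := by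
      rw [← Finset.prod_mul_distrib]
      rfl
    have hp0 : 0 ≤ ∏ t, p (a t).1 := Finset.prod_nonneg fun t _ => hp.1 _
    have hs0 : 0 < s := by positivity
    have e1 : 0 ≤ if n * δ ≤ |∑ t, f (a t) - n * multiInfo (jointLaw p V)| then ∏ t, P (a t)
        else 0 := by
      split_ifs
      exacts [hPn a, le_rfl]
    have e2 : ∀ i, 0 ≤ (∏ t, P (a t)) * (if s * m i * ∏ t, r i ((a t).2 i) <
        Q i (fun t => (a t).2 i) then 1 else 0) := fun i =>
      mul_nonneg (hPn a) (by split_ifs <;> norm_num)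
    have e3 : 0 ≤ (∏ t, p (a t).1) * max ((∏ t, V (a t).1 (a t).2) -
        T (fun t => (a t).1) (fun i t => (a t).2 i)) 0 := mul_nonneg hp0 (le_max_right _ _)
    have e4 : 0 ≤ s⁻¹ * ∏ t, P (a t) := mul_nonneg (by positivity) (hPn a)
    have e5 := Finset.sum_nonneg fun i (_ : i ∈ Finset.univ) => e2 i
    by_cases hP0 : ∏ t, P (a t) = 0
    · linarith
    by_cases hbad : n * δ ≤ |∑ t, f (a t) - n * multiInfo (jointLaw p V)|
    · rw [if_pos hbad]
      linarith
    by_cases hbad' : ∃ i, s * m i * ∏ t, r i ((a t).2 i) < Q i (fun t => (a t).2 i)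
    · obtain ⟨i, hi⟩ := hbad'
      have h4 := Finset.single_le_sum (fun i _ => e2 i) (Finset.mem_univ i)
      rw [if_pos hi, mul_one] at h4
      linarith
    have hTV : T (fun t => (a t).1) (fun i t => (a t).2 i) ≤ s⁻¹ * ∏ t, V (a t).1 (a t).2 := by
      simp only [not_exists, not_lt] at hbad'
      have hVr : ∏ t, V (a t).1 (a t).2 =
          (2 : ℝ) ^ (∑ t, f (a t)) * ∏ i, ∏ t, r i ((a t).2 i) := by
        rw [Finset.prod_comm, Real.rpow_sum_of_pos (by norm_num), ← Finset.prod_mul_distrib]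
        refine Finset.prod_congr rfl fun t _ => ?_
        have hPt : P (a t) ≠ 0 := Finset.prod_ne_zero_iff.1 hP0 t (Finset.mem_univ t)
        have hPt' : 0 < P (a t) := lt_of_le_of_ne (hPs.1 _) (Ne.symm hPt)
        have hVt : 0 < V (a t).1 (a t).2 :=
          lt_of_le_of_ne ((hV _).1 _) fun h => hPt (mul_eq_zero_of_right _ h.symm)
        have hrt : 0 < ∏ i, r i ((a t).2 i) := Finset.prod_pos fun i _ =>
          hPt'.trans_le (le_outputMarginal (jointLaw_nonneg hp hV) i (a t).1 (a t).2)
        rw [hf, Real.rpow_logb (by norm_num) (by norm_num) (div_pos hVt hrt),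
          div_mul_cancel₀ _ hrt.ne']
      have hr0 : 0 ≤ ∏ i, ∏ t, r i ((a t).2 i) := Finset.prod_nonneg fun i _ =>
        Finset.prod_nonneg fun t _ => (outputMarginal_mem_stdSimplex hp hV i).1 _
      refine (hTQ _ _).trans ((Finset.prod_le_prod (fun i _ => hQ i _)
        fun i _ => hbad' i).trans ?_)
      rw [Finset.prod_mul_distrib, Finset.prod_mul_distrib, hVr, Finset.prod_const,
        Finset.card_univ, ← mul_assoc]
      refine mul_le_mul_of_nonneg_right ?_ hr0
      refine (mul_le_mul_of_nonneg_left hmR (by positivity)).trans ?_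
      rw [hs, ← Real.rpow_natCast, ← Real.rpow_mul (by norm_num), ← Real.rpow_neg (by norm_num),
        ← Real.rpow_add (by norm_num), ← Real.rpow_add (by norm_num)]
      -- The slack of `card ι + 2` copies of `δ` is used up: one for each factor `s`, one for the
      -- Chebyshev deviation, one for the gain `s⁻¹`.
      refine Real.rpow_le_rpow_of_exponent_le (by norm_num) ?_
      have h5 := neg_abs_le (∑ t, f (a t) - n * multiInfo (jointLaw p V))
      have h6 := mul_le_mul_of_nonneg_left hR hn'.le
      linarith
    have h7 := le_max_left ((∏ t, V (a t).1 (a t).2) -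
      T (fun t => (a t).1) (fun i t => (a t).2 i)) 0
    have h8 : ∏ t, P (a t) ≤ (∏ t, p (a t).1) * max ((∏ t, V (a t).1 (a t).2) -
        T (fun t => (a t).1) (fun i t => (a t).2 i)) 0 + s⁻¹ * ∏ t, P (a t) := by
      rw [hsplit, mul_left_comm, ← mul_add]
      exact mul_le_mul_of_nonneg_left (by linarith) hp0
    linarith
  have hsum := Finset.sum_le_sum fun a (_ : a ∈ Finset.univ) => hpoint a
  have hone : ∑ a : Fin n → X × ∀ i, Y i, ∏ t, P (a t) = 1 :=
    (prod_mem_stdSimplex fun _ : Fin n => hPs).2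
  rw [Finset.sum_add_distrib, Finset.sum_add_distrib, Finset.sum_add_distrib, ← Finset.mul_sum,
    hone, ← Finset.sum_filter, Finset.sum_comm] at hsum
  have htv : ∑ a : Fin n → X × ∀ i, Y i, (∏ t, p (a t).1) * max ((∏ t, V (a t).1 (a t).2) -
        T (fun t => (a t).1) (fun i t => (a t).2 i)) 0 ≤ ε := by
    refine le_trans (le_of_eq ?_) hε
    rw [← sum_words fun x y => (∏ t, p (x t)) *
      max ((∏ t, V (x t) fun i => y i t) - T x y) 0]
    refine Finset.sum_congr rfl fun x _ => ?_
    rw [← Finset.mul_sum, sum_max_sub_eq_tvd]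
    rw [(hT x).2, sum_pi_swap]
    exact (prod_mem_stdSimplex fun t => hV (x t)).2
  have hsi : s⁻¹ = (2 : ℝ) ^ (-(n * δ)) := by rw [hs, Real.rpow_neg (by norm_num)]
  have h3 := Finset.sum_le_card_nsmul Finset.univ _ _ fun i _ => h2 i
  rw [Finset.card_univ, nsmul_eq_mul] at h3
  rw [← hsi]
  linarith

omit [Fintype X] in
-- Data processing: a code for all receivers is at least as accurate for those in `J`.
theorem tvd_reducedChannel_le (J : Finset ι) (U V : X → (∀ i, Y i) → ℝ) (x : X) :
    tvd (reducedChannel J U x) (reducedChannel J V x) ≤ tvd (U x) (V x) := by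
  classical
  unfold tvd
  refine mul_le_mul_of_nonneg_left ?_ (by norm_num)
  rw [← Finset.sum_fiberwise (s := Finset.univ) (g := fun y : ∀ i, Y i => J.restrict y)]
  refine Finset.sum_le_sum fun z _ => ?_
  unfold reducedChannel
  rw [← Finset.sum_sub_distrib]
  exact (Finset.abs_sum_le_sum_abs _ _).trans (le_of_eq (by congr!))

end StrongConverse

/-! ### The rate region -/

section Region

variable {K : ℕ} {X : Type*} [Fintype X] {Y : Fin K → Type*} [∀ i, Fintype (Y i)]
  {W : X → (∀ i, Y i) → ℝ}

/-- Strong converse: rates that are attainable with some error less than one dominate the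
multipartite information of every reduced channel under every input distribution. -/
theorem multiInfo_le_sum_of_attainable (hW : IsChannel W) {ε : ℝ} (hε1 : ε < 1) {r : Fin K → ℝ}
    (hr : ∀ i, 0 ≤ r i) {N : ℕ} (hN : ∀ n ≥ N,
      Attainable ε (powerChannel n W) fun i => ⌊(2 : ℝ) ^ ((n : ℝ) * r i)⌋₊)
    (J : Finset (Fin K)) {p : X → ℝ} (hp : p ∈ stdSimplex ℝ X) :
    multiInfo (jointLaw p (reducedChannel J W)) ≤ ∑ i ∈ J, r i := by
  by_contra! hlt
  have hV := isChannel_reducedChannel J hW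
  set V := reducedChannel J W with hVdef
  set δ : ℝ := (multiInfo (jointLaw p V) - ∑ i ∈ J, r i) / (Fintype.card J + 2) with hδdef
  have hδ : 0 < δ := div_pos (by linarith) (by positivity)
  have hR : ∑ i ∈ J, r i + (Fintype.card J + 2) * δ ≤ multiInfo (jointLaw p V) := by
    rw [hδdef, mul_div_cancel₀ _ (by positivity)]
    linarith
  -- Here `p` is fixed, so the single-letter density has a bound independent of `n`.
  obtain ⟨B, hB⟩ := (Set.finite_range fun u : X × (∀ j : J, Y j) => |Real.logb 2
    (V u.1 u.2 / ∏ i, outputMarginal (jointLaw p V) i (u.2 i))|).bddAbove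
  have h1 : Filter.Tendsto (fun n : ℕ => (n : ℝ) * B ^ 2 / (n * δ) ^ 2)
      Filter.atTop (nhds 0) := by
    have h := (tendsto_inv_atTop_nhds_zero_nat (𝕜 := ℝ)).const_mul (B ^ 2 / δ ^ 2)
    rw [mul_zero] at h
    refine h.congr' ?_
    filter_upwards [Filter.eventually_gt_atTop 0] with n hn
    have hn' : (n : ℝ) ≠ 0 := by positivity
    field_simp
  have h2 := tendsto_poly_mul_rpow_neg (Fintype.card J + 1) 0 hδ
  have h3 := (h1.add h2).add_const ε
  have h4 : (0 : ℝ) + 0 + ε < 1 := by linarith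
  obtain ⟨n, hn1, hn2, hnN⟩ := ((h3.eventually_lt_const h4).and
    ((Filter.eventually_gt_atTop 0).and (Filter.eventually_ge_atTop N))).exists
  obtain ⟨c, hc⟩ := hN n hnN
  have h5 := hc _ (prod_mem_stdSimplex fun _ : Fin n => hp)
  rw [tvd_jointLaw (prod_mem_stdSimplex fun _ : Fin n => hp)] at h5
  have h6 := one_le_of_le_prod hp hV (fun x y => hB ⟨(x, y), rfl⟩) hδ hR hn2
    (isChannel_reducedChannel J c.isChannel_induced)
    (fun j : J => c.decoderMass_nonneg j)
    (m := fun j : J => ((⌊(2 : ℝ) ^ ((n : ℝ) * r j)⌋₊ : ℕ) : ℝ))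
    (fun j => Nat.cast_pos.2 (Nat.floor_pos.2
      (Real.one_le_rpow (by norm_num) (mul_nonneg (Nat.cast_nonneg _) (hr j)))))
    (fun j => (c.sum_decoderMass j).le) ?_ (c.reducedChannel_induced_le J)
    (le_trans (Finset.sum_le_sum fun x _ => mul_le_mul_of_nonneg_left ?_
      ((prod_mem_stdSimplex fun _ : Fin n => hp).1 x)) h5)
  · simp only [pow_zero, one_mul] at hn1
    linarith
  · rw [Finset.mul_sum, Real.rpow_sum_of_pos (by norm_num), ← Finset.prod_coe_sort J]
    exact Finset.prod_le_prod (fun j _ => by positivity) fun j _ => Nat.floor_le (by positivity)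
  · have h7 := tvd_reducedChannel_le J c.induced (powerChannel n W) x
    have h8 : reducedChannel J (powerChannel n W) x =
        fun z => ∏ t, V (x t) fun j => z j t :=
      funext fun z => reducedChannel_powerChannel J W x z
    rwa [h8] at h7

theorem rateRegion_eq [Nonempty X] (hW : IsChannel W) {ε : ℝ} (hε0 : 0 < ε) (hε1 : ε < 1) :
    rateRegion ε W = {r | (∀ i, 0 ≤ r i) ∧ ∀ J : Finset (Fin K), J.Nonempty →
      multiCapacity (reducedChannel J W) ≤ ∑ i ∈ J, r i} := by
  refine Set.Subset.antisymm (closure_minimal ?_ ?_) ?_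
  · rintro r ⟨hr, N, hN⟩
    refine ⟨hr, fun J _ => ?_⟩
    obtain ⟨p, hp, hpJ⟩ := (isGreatest_multiCapacity (isChannel_reducedChannel J hW)).1
    rw [← hpJ]
    exact multiInfo_le_sum_of_attainable hW hε1 hr hN J hp
  · simp only [Set.ofPred_and, Set.ofPred_forall]
    refine IsClosed.inter (isClosed_iInter fun i => isClosed_le continuous_const
      (continuous_apply i)) (isClosed_iInter fun J => isClosed_iInter fun _ =>
        isClosed_le continuous_const (continuous_finsetSum _ fun i _ => continuous_apply i))
  · rintro r ⟨hr, hrC⟩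
    -- Raising every rate by `2 * δ` with `δ = 1 / (k + 1)` gives each nonempty `J` the slack `2 *
    -- δ` that achievability asks for.
    have h1 : Filter.Tendsto (fun (k : ℕ) (i : Fin K) => r i + 2 * (1 / ((k : ℝ) + 1)))
        Filter.atTop (nhds r) := by
      refine tendsto_pi_nhds.2 fun i => ?_
      simpa using (tendsto_one_div_add_atTop_nhds_zero_nat (𝕜 := ℝ)).const_mul 2 |>.const_add (r i)
    refine mem_closure_of_tendsto h1 (Filter.Eventually.of_forall fun k => ?_)
    have hk : (0 : ℝ) < 1 / ((k : ℝ) + 1) := by positivity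
    have hr' : ∀ i, 0 ≤ r i + 2 * (1 / ((k : ℝ) + 1)) := fun i => by linarith [hr i]
    refine ⟨hr', exists_forall_attainable hW hε0 hk hr' fun J hJ => ?_⟩
    rw [Finset.sum_add_distrib, Finset.sum_const, nsmul_eq_mul]
    have hc : (1 : ℝ) ≤ J.card := by exact_mod_cast hJ.card_pos
    have h2 := hrC J hJ
    nlinarith

theorem rateRegion_two_eq [Nonempty X] {Y : Fin 2 → Type*} [∀ i, Fintype (Y i)]
    {W : X → (∀ i, Y i) → ℝ} (hW : IsChannel W) {ε : ℝ} (hε0 : 0 < ε) (hε1 : ε < 1) :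
    rateRegion ε W = {r | (∀ i, 0 ≤ r i) ∧ capacity (outputChannel 0 W) ≤ r 0 ∧
      capacity (outputChannel 1 W) ≤ r 1 ∧ multiCapacity W ≤ r 0 + r 1} := by
  rw [rateRegion_eq hW hε0 hε1]
  ext r
  refine and_congr_right fun _ => ⟨fun h => ⟨?_, ?_, ?_⟩, fun ⟨h0, h1, h2⟩ J hJ => ?_⟩
  · simpa [multiCapacity_singleton hW] using h {0} (Finset.singleton_nonempty 0)
  · simpa [multiCapacity_singleton hW] using h {1} (Finset.singleton_nonempty 1)
  · have h2 := h Finset.univ Finset.univ_nonempty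
    rwa [multiCapacity_univ hW, Fin.sum_univ_two] at h2
  · have hJ' : J = {0} ∨ J = {1} ∨ J = Finset.univ := by
      revert hJ
      revert J
      decide
    rcases hJ' with rfl | rfl | rfl
    · rwa [multiCapacity_singleton hW, Finset.sum_singleton]
    · rwa [multiCapacity_singleton hW, Finset.sum_singleton]
    · rwa [multiCapacity_univ hW, Fin.sum_univ_two]

end Region

end BroadcastSimulation

end

theorem mainTheorem1 {X : Type*} [Fintype X] [Nonempty X] {ε : ℝ} (hε0 : 0 < ε) (hε1 : ε < 1) :
    -- any number of receivers
    (∀ (K : ℕ) (Y : Fin K → Type*) [∀ i, Fintype (Y i)] (W : X → (∀ i, Y i) → ℝ),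
      BroadcastSimulation.IsChannel W →
        BroadcastSimulation.rateRegion ε W =
          {r | (∀ i, 0 ≤ r i) ∧ ∀ J : Finset (Fin K), J.Nonempty →
            BroadcastSimulation.multiCapacity (BroadcastSimulation.reducedChannel J W)
              ≤ ∑ i ∈ J, r i} ∧
        -- each `C̃` is an attained maximum over the input distributions
        (∀ J : Finset (Fin K), J.Nonempty →
          IsGreatest
            ((fun p : X → ℝ => BroadcastSimulation.multiInfo
              (BroadcastSimulation.jointLaw p (BroadcastSimulation.reducedChannel J W))) ''
                stdSimplex ℝ X)
            (BroadcastSimulation.multiCapacity (BroadcastSimulation.reducedChannel J W))) ∧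
        -- for a singleton, `C̃` is the ordinary capacity
        (∀ i : Fin K,
          BroadcastSimulation.multiCapacity (BroadcastSimulation.reducedChannel {i} W) =
            BroadcastSimulation.capacity (BroadcastSimulation.outputChannel i W))) ∧
    -- two receivers
    (∀ (Y : Fin 2 → Type*) [∀ i, Fintype (Y i)] (W : X → (∀ i, Y i) → ℝ),
      BroadcastSimulation.IsChannel W →
        BroadcastSimulation.rateRegion ε W =
          {r | (∀ i, 0 ≤ r i) ∧
            BroadcastSimulation.capacity (BroadcastSimulation.outputChannel 0 W) ≤ r 0 ∧
            BroadcastSimulation.capacity (BroadcastSimulation.outputChannel 1 W) ≤ r 1 ∧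
            BroadcastSimulation.multiCapacity W ≤ r 0 + r 1}) := by
  refine ⟨fun K Y _ W hW => ⟨BroadcastSimulation.rateRegion_eq hW hε0 hε1, fun J _ =>
    BroadcastSimulation.isGreatest_multiCapacity
      (BroadcastSimulation.isChannel_reducedChannel J hW), fun i =>
        BroadcastSimulation.multiCapacity_singleton hW i⟩,
    fun Y _ W hW => BroadcastSimulation.rateRegion_two_eq hW hε0 hε1⟩
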